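/- **Setting.** Let $N\ge 0$ and $\eta,\xi_1,\dots,\xi_N,\zeta_-,\kappa_-,\tau_-,\alpha_-,\beta_-,\alpha,\beta\in\mathbb C$ with $\sinh\alpha_-\cosh\beta_-=\frac{\sinh\zeta_-}{2\kappa_-}$, $\cosh\alpha_-\sinh\beta_-=\frac{\cosh\zeta_-}{2\kappa_-}$. Let $\mathcal H=(\mathbb C^2)^{\otimes N}$ and let $$R(\lambda)=\begin{pmatrix}\sinh(\lambda+\eta)&0&0&0\\0&\sinh\lambda&\sinh\eta&0\\0&\sinh\eta&\sinh\lambda&0\\0&0&0&\sinh(\lambda+\eta)\end{pmatrix},\quad M(\lambda)=R_{0N}(\lambda-\xi_N-\tfrac\eta2)\cdots R_{01}(\lambda-\xi_1-\tfrac\eta2),$$ $\hat M(\lambda)=(-1)^N\sigma_0^y M^{t_0}(-\lambda)\sigma_0^y$, $\ \mathcal U_-(\lambda)=M(\lambda)K_-(\lambda)\hat M(\lambda)$ with $$K_-(\lambda)=\frac1{\sinh\zeta_-}\begin{pmatrix}\sinh(\lambda-\frac\eta2+\zeta_-)&\kappa_-e^{\tau_-}\sinh(2\lambda-\eta)\\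 \kappa_-e^{-\tau_-}\sinh(2\lambda-\eta)&\sinh(\zeta_--\lambda+\frac\eta2)\end{pmatrix}.$$ For any gauge parameter $\beta$ put $$\tilde G(\lambda|\beta)=\begin{pmatrix}e^{-[\lambda+(\alpha+\beta+1)\eta]}&e^{-[\lambda+(\alpha-\beta+1)\eta]}\\1&1\end{pmatrix},\quad e^{-\lambda+\eta/2}\,\tilde G^{-1}(\lambda-\tfrac\eta2|\beta)\,\mathcal U_-(\lambda)\,\tilde G(\tfrac\eta2-\lambda|\beta)=\begin{pmatrix}\mathcal A_-(\lambda|\beta+2)&\mathcal B_-(\lambda|\beta)\\ \mathcal C_-(\lambda|\beta+2)&\mathcal D_-(\lambda|\beta)\end{pmatrix},$$ and let $\mathsf A_-(\lambda)=g_-(\lambda)a(\lambda)d(-\lambda)$ with $a(\lambda)=\prod_n\sinh(\lambda-\xi_n+\frac\eta2)$, $d(\lambda)=a(\lambda-\eta)$, $g_-(\lambda)=\frac{\sinh(\lambda+\alpha_--\eta/2)\cosh(\lambda+\beta_--\eta/2)}{\sinh\alpha_-\cosh\beta_-}$. The reference states are $\langle\beta|=\bigotimes_{n=1}^N(-1,\,e^{-\alpha\eta+(N-n+\beta)\eta-\xi_n})$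 and $|\beta\rangle=\bigotimes_{n=1}^N\binom{e^{-\alpha\eta-(N-n+\beta)\eta-\xi_n}}{1}$. For $\mathbf h\in\{0,1\}^N$ the SOV states are (factors ordered from left to right by increasing $n$) $$\langle\beta,\mathbf h|=\langle\beta|\prod_{n=1}^N\Big(\frac{\mathcal A_-(\frac\eta2-\xi_n|\beta+2)}{\mathsf A_-(\frac\eta2-\xi_n)}\Big)^{h_n},\qquad |\beta,\mathbf h\rangle=\prod_{n=1}^N\Big(\frac{\mathcal D_-(\xi_n+\frac\eta2|\beta)}{k_n\,\mathsf A_-(\frac\eta2-\xi_n)}\Big)^{1-h_n}|-\beta+2\rangle,\quad k_n=\frac{\sinh(2\xi_n+\eta)}{\sinh(2\xi_n-\eta)}.$$ Let $|\mathbf h\rangle,\langle\mathbf h|$ be the spin bases, $\sigma^z_n|\mathbf h\rangle=(2h_n-1)|\mathbf h\rangle$, and define $U^{(L,\beta)},U^{(R,\beta)}$ by $\langle\beta,\mathbf h|=\langle\mathbf h|U^{(L,\beta)}$, $|\beta,\mathbf h\rangle=U^{(R,\beta)}|\mathbf h\rangle$, rows and columns being numbered through $\varkappa(\mathbf h)=1+\sum_a2^{a-1}h_a$.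 Finally $\eta_a^{(h)}=\cosh2[\xi_a+(h-\frac12)\eta]$ and $$Z(\beta)=\prod_{1\le b<a\le N}(\eta_a^{(1)}-\eta_b^{(1)})\ \langle\beta|\prod_{n=1}^N\frac{\mathcal A_-(\frac\eta2-\xi_n|\beta+2)}{\mathsf A_-(\frac\eta2-\xi_n)}|-\beta\rangle .$$ **Genericity.** Assume $\sinh\eta,\ \sinh\zeta_-,\ \kappa_-,\ \sinh\beta\eta,\ \sinh(\beta-2)\eta\ne0$; $\sinh(\alpha_--\xi_a)\ne0$ and $\cosh(\beta_--\xi_a)\ne0$ for all $a$; and, for $r\in\{-1,0,1\}$, $\sinh(\xi_a-\xi_b+r\eta)\neq0$ for $a\ne b$ and $\sinh(\xi_a+\xi_b+r\eta)\ne0$ for all $a,b$. **Proposition.** (1) The matrix $M=U^{(L,\beta-2)}U^{(R,\beta)}$ is diagonal, and for all $\mathbf h,\mathbf k\in\{0,1\}^N$ $$M_{\varkappa(\mathbf h)\varkappa(\mathbf k)}=\langle\beta-2,\mathbf h|\beta,\mathbf k\rangle=\delta_{\mathbf h,\mathbf k}\,Z(\beta-2)\prod_{1\le b<a\le N}\frac1{\eta_a^{(h_a)}-\eta_b^{(h_b)}}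 .$$ (2) If moreover $(\alpha-\beta+2j)\eta\ne(N-1)\eta-\tau_--(-1)^k(\alpha_-+\beta_-)+i\pi k$ for all $j\in\{1,\dots,N\}$ and $k\in\mathbb Z$, then $Z(\beta-2)\neq0$, all $\langle\beta-2,\mathbf h|\beta,\mathbf h\rangle$ are non-zero, and $$\mathbb I=\sum_{\mathbf h}\frac{|\beta,\mathbf h\rangle\langle\beta-2,\mathbf h|}{\langle\beta-2,\mathbf h|\beta,\mathbf h\rangle}=\frac1{Z(\beta-2)}\sum_{\mathbf h\in\{0,1\}^N}\ \prod_{1\le b<a\le N}(\eta_a^{(h_a)}-\eta_b^{(h_b)})\ |\beta,\mathbf h\rangle\langle\beta-2,\mathbf h| .$$ (3) If $\sinh(2\xi_n+\beta\eta)\ne0$ for all $n$ and the right states are normalized by $f_n(\beta)=k_n\frac{\sinh\beta\eta}{\sinh(2\xi_n+\beta\eta)}$ in place of $k_n$, then the pairing $\langle\beta-2,\mathbf h|\beta,\mathbf k\rangle$ equals the right-hand side of (1) times $\prod_n\big(\frac{\sinh(2\xi_n+\beta\eta)}{\sinh\beta\eta}\big)^{1-h_n}$. -/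

import Mathlib

open Complex Matrix

namespace OpenXXZ

/-- A configuration of labels in `{0,1}^N`. -/
abbrev Config (N : ℕ) := Fin N → Fin 2

/-- Operators on the quantum space `H = (ℂ²)^{⊗ N}`, written in the tensor product basis: the
component `0 : Fin 2` of a factor `ℂ²` is the upper one (spin up), `1 : Fin 2` the lower one. -/
abbrev Op (N : ℕ) := Matrix (Config N) (Config N) ℂ

/-- Operators on `H₀ ⊗ H`, as `2 × 2` matrices (auxiliary space `H₀`) of operators on `H`. -/
abbrev AuxOp (N : ℕ) := Matrix (Fin 2) (Fin 2) (Op N)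

/-- The parameters of the chain with `N` sites: anisotropy `η`, inhomogeneities `ξ`, the parameters
`ζ_-, κ_-, τ_-` of the boundary matrix `K_-`, the derived parameters `α_-, β_-` (related to the
former by `BoundaryRelation`), and the gauge parameter `α`. -/
structure Params (N : ℕ) where
  η : ℂ
  ξ : Fin N → ℂ
  ζm : ℂ
  κm : ℂ
  τm : ℂ
  αm : ℂ
  βm : ℂ
  α : ℂ

/-- The six-vertex `R`-matrix on `ℂ² ⊗ ℂ²`, in the basis `(0,0), (0,1), (1,0), (1,1)`. -/
noncomputable def rMatrix (η lam : ℂ) : Matrix (Fin 2 × Fin 2) (Fin 2 × Fin 2) ℂ :=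
  (!![sinh (lam + η), 0, 0, 0;
      0, sinh lam, sinh η, 0;
      0, sinh η, sinh lam, 0;
      0, 0, 0, sinh (lam + η)] : Matrix (Fin 4) (Fin 4) ℂ).submatrix
    (finProdFinEquiv : Fin 2 × Fin 2 ≃ Fin (2 * 2)) (finProdFinEquiv : Fin 2 × Fin 2 ≃ Fin (2 * 2))

/-- The operator on `H` that acts as `m` on the `n`-th factor and trivially on the others. -/
noncomputable def siteOp {N : ℕ} (n : Fin N) (m : Matrix (Fin 2) (Fin 2) ℂ) : Op N :=
  Matrix.of fun s t => if ∀ k, k ≠ n → s k = t k then m (s n) (t n) else 0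

/-- `R_{0n}(λ)`, acting on the auxiliary space and the `n`-th quantum space. -/
noncomputable def rAux {N : ℕ} (η : ℂ) (n : Fin N) (lam : ℂ) : AuxOp N :=
  Matrix.of fun i j => siteOp n (Matrix.of fun s t => rMatrix η lam (i, s) (j, t))

/-- A `2 × 2` matrix of numbers as an operator on `H₀ ⊗ H`. -/
noncomputable def auxScalar (N : ℕ) (m : Matrix (Fin 2) (Fin 2) ℂ) : AuxOp N :=
  m.map fun c => c • (1 : Op N)

/-- The Pauli matrix `σ^y`. -/
noncomputable def sigmaY : Matrix (Fin 2) (Fin 2) ℂ := !![0, -I; I, 0]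

namespace Params

variable {N : ℕ} (p : Params N)

/-- Bulk monodromy matrix `M(λ) = R_{0N}(λ - ξ_N - η/2) ⋯ R_{01}(λ - ξ_1 - η/2)`. -/
noncomputable def bulk (lam : ℂ) : AuxOp N :=
  (List.ofFn fun n : Fin N => rAux p.η n (lam - p.ξ n - p.η / 2)).reverse.prod

/-- `M̂(λ) = (-1)^N σ₀^y M^{t₀}(-λ) σ₀^y`; the transposition `t₀` is that of the auxiliary space
only. -/
noncomputable def bulkHat (lam : ℂ) : AuxOp N :=
  ((-1 : ℂ) ^ N) • (auxScalar N sigmaY * (p.bulk (-lam))ᵀ * auxScalar N sigmaY)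

/-- The scalar boundary matrix `K_-(λ)`. -/
noncomputable def boundaryK (lam : ℂ) : Matrix (Fin 2) (Fin 2) ℂ :=
  (1 / sinh p.ζm) •
    !![sinh (lam - p.η / 2 + p.ζm), p.κm * exp p.τm * sinh (2 * lam - p.η);
       p.κm * exp (-p.τm) * sinh (2 * lam - p.η), sinh (p.ζm - lam + p.η / 2)]

/-- Boundary monodromy matrix `U_-(λ) = M(λ) K_-(λ) M̂(λ)`. -/
noncomputable def boundaryU (lam : ℂ) : AuxOp N :=
  p.bulk lam * auxScalar N (p.boundaryK lam) * p.bulkHat lam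

/-- The column `X(λ|β)`. -/
noncomputable def gaugeX (lam β : ℂ) : Fin 2 → ℂ := ![exp (-(lam + (p.α + β) * p.η)), 1]

/-- The column `Y(λ|β)`. -/
noncomputable def gaugeY (lam β : ℂ) : Fin 2 → ℂ := ![exp (-(lam + (p.α - β) * p.η)), 1]

/-- The gauge matrix `G̃(λ|β)` with columns `X(λ|β+1)` and `Y(λ|β-1)`. -/
noncomputable def gaugeG (lam β : ℂ) : Matrix (Fin 2) (Fin 2) ℂ :=
  (Matrix.of ![p.gaugeX lam (β + 1), p.gaugeY lam (β - 1)])ᵀ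

/-- The determinant of `G̃(λ|β)` vanishes only if `sinh (β η)` does, so that the inverse used in
`gaugedU` is a genuine one as soon as `sinh (β η) ≠ 0`. -/
theorem det_gaugeG (lam β : ℂ) :
    (p.gaugeG lam β).det = -2 * exp (-(lam + (p.α + 1) * p.η)) * sinh (β * p.η) := by
  have h1 : exp (-(lam + (p.α + (β + 1)) * p.η))
      = exp (-(lam + (p.α + 1) * p.η)) * exp (-(β * p.η)) := by
    rw [← Complex.exp_add]; ring_nf
  have h2 : exp (-(lam + (p.α - (β - 1)) * p.η))
      = exp (-(lam + (p.α + 1) * p.η)) * exp (β * p.η) := by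
    rw [← Complex.exp_add]; ring_nf
  have h3 : (p.gaugeG lam β).det = exp (-(lam + (p.α + (β + 1)) * p.η)) * 1
      - exp (-(lam + (p.α - (β - 1)) * p.η)) * 1 := by
    rw [Matrix.det_fin_two]; rfl
  rw [h3, h1, h2, Complex.sinh]
  ring

/-- Gauge transformed boundary monodromy matrix
`U_-(λ|β) = e^{-λ+η/2} G̃⁻¹(λ-η/2|β) U_-(λ) G̃(η/2-λ|β)`, with matrix elements
`A_-(λ|β+2), B_-(λ|β); C_-(λ|β+2), D_-(λ|β)`. -/
noncomputable def gaugedU (lam β : ℂ) : AuxOp N :=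
  exp (-lam + p.η / 2) •
    (auxScalar N (p.gaugeG (lam - p.η / 2) β)⁻¹ * p.boundaryU lam *
      auxScalar N (p.gaugeG (p.η / 2 - lam) β))

/-- `A_-(λ|β)`, the upper left element of `U_-(λ|β-2)`. -/
noncomputable def opA (lam β : ℂ) : Op N := p.gaugedU lam (β - 2) 0 0

/-- `D_-(λ|β)`, the lower right element of `U_-(λ|β)`. -/
noncomputable def opD (lam β : ℂ) : Op N := p.gaugedU lam β 1 1

/-- The relations that define `α_-, β_-` in terms of `ζ_-, κ_-`. -/
def BoundaryRelation : Prop :=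
  sinh p.αm * cosh p.βm = sinh p.ζm / (2 * p.κm) ∧
  cosh p.αm * sinh p.βm = cosh p.ζm / (2 * p.κm)

/-- `g_-(λ)`. -/
noncomputable def gMinus (lam : ℂ) : ℂ :=
  sinh (lam + p.αm - p.η / 2) * cosh (lam + p.βm - p.η / 2) / (sinh p.αm * cosh p.βm)

/-- `a(λ) = ∏ sinh (λ - ξ_n + η/2)`. -/
noncomputable def aFun (lam : ℂ) : ℂ := ∏ n, sinh (lam - p.ξ n + p.η / 2)

/-- `d(λ) = a(λ - η)`. -/
noncomputable def dFun (lam : ℂ) : ℂ := p.aFun (lam - p.η)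

/-- The scalar function `𝖠_-(λ) = g_-(λ) a(λ) d(-λ)`. -/
noncomputable def AMinus (lam : ℂ) : ℂ := p.gMinus lam * p.aFun lam * p.dFun (-lam)

/-- The left reference state `⟨β| = ⊗_n (-1, e^{-αη + (N-n+β)η - ξ_n})`, `n = 1, …, N`. -/
noncomputable def leftRef (β : ℂ) : Config N → ℂ := fun s =>
  ∏ n : Fin N,
    (![-1, exp (-p.α * p.η + ((N : ℂ) - ((n : ℕ) + 1) + β) * p.η - p.ξ n)] : Fin 2 → ℂ) (s n)

/-- The right reference state `|β⟩ = ⊗_n (e^{-αη - (N-n+β)η - ξ_n}, 1)ᵗ`, `n = 1, …, N`. -/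
noncomputable def rightRef (β : ℂ) : Config N → ℂ := fun s =>
  ∏ n : Fin N,
    (![exp (-p.α * p.η - ((N : ℂ) - ((n : ℕ) + 1) + β) * p.η - p.ξ n), 1] : Fin 2 → ℂ) (s n)

/-- The left SOV state `⟨β,h| = ⟨β| ∏_n (A_-(η/2-ξ_n|β+2) / 𝖠_-(η/2-ξ_n))^{h_n}`, the factors being
written from left to right. -/
noncomputable def leftSOV (β : ℂ) (h : Config N) : Config N → ℂ :=
  p.leftRef β ᵥ* (List.ofFn fun n : Fin N =>
    ((1 / p.AMinus (p.η / 2 - p.ξ n)) • p.opA (p.η / 2 - p.ξ n) (β + 2)) ^ (h n : ℕ)).prod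

/-- The right SOV state `|β,h⟩ = ∏_n (D_-(ξ_n+η/2|β) / (c_n 𝖠_-(η/2-ξ_n)))^{1-h_n} |-β+2⟩`, with
normalization coefficients `c_n`, the factors being written from left to right. -/
noncomputable def rightSOV (c : Fin N → ℂ) (β : ℂ) (h : Config N) : Config N → ℂ :=
  (List.ofFn fun n : Fin N =>
    ((1 / (c n * p.AMinus (p.η / 2 - p.ξ n))) • p.opD (p.ξ n + p.η / 2) β) ^
      (1 - (h n : ℕ))).prod *ᵥ p.rightRef (-β + 2)

/-- The normalization `k_n = sinh (2ξ_n+η) / sinh (2ξ_n-η)` of the right SOV states. -/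
noncomputable def kNorm (n : Fin N) : ℂ := sinh (2 * p.ξ n + p.η) / sinh (2 * p.ξ n - p.η)

/-- The normalization `f_n(β) = k_n sinh (βη) / sinh (2ξ_n+βη)`. -/
noncomputable def fNorm (β : ℂ) (n : Fin N) : ℂ :=
  sinh (2 * p.ξ n + p.η) * sinh (β * p.η) /
    (sinh (2 * p.ξ n - p.η) * sinh (2 * p.ξ n + β * p.η))

/-- `η_a^{(h)} = cosh 2(ξ_a + (h - 1/2)η)`. -/
noncomputable def etaVal (a : Fin N) (h : Fin 2) : ℂ :=
  cosh (2 * (p.ξ a + (((h : ℕ) : ℂ) - 1 / 2) * p.η))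

/-- `Z(β) = ∏_{b<a} (η_a^{(1)} - η_b^{(1)}) ⟨β| ∏_n A_-(η/2-ξ_n|β+2) / 𝖠_-(η/2-ξ_n) |-β⟩`. -/
noncomputable def normZ (β : ℂ) : ℂ :=
  (∏ a : Fin N, ∏ b ∈ Finset.Iio a, (p.etaVal a 1 - p.etaVal b 1)) *
    (p.leftRef β ⬝ᵥ ((List.ofFn fun n : Fin N =>
      (1 / p.AMinus (p.η / 2 - p.ξ n)) • p.opA (p.η / 2 - p.ξ n) (β + 2)).prod *ᵥ
        p.rightRef (-β)))

end Params

/-- The bijection `h ↦ ∑_a 2^(a-1) h_a` of `{0,1}^N` with `{0, …, 2^N - 1}`. -/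
def kappa (N : ℕ) : Config N ≃ Fin (2 ^ N) := finFunctionFinEquiv

/-- The position in the tensor product basis of the spin basis vector `|k⟩ = ⊗_n |k_n,n⟩` with
`σ_n^z |k_n,n⟩ = (2k_n-1) |k_n,n⟩`: here `k_n = 1` is spin up, the component `0`. -/
def spinPos {N : ℕ} (k : Config N) : Config N := fun n => (k n).rev

namespace Params

variable {N : ℕ} (p : Params N)

/-- `U^{(L,β)}`: its rows are the coordinates of the left SOV states in the spin basis. -/
noncomputable def matUL (β : ℂ) : Matrix (Fin (2 ^ N)) (Fin (2 ^ N)) ℂ :=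
  Matrix.of fun i j => p.leftSOV β ((kappa N).symm i) (spinPos ((kappa N).symm j))

/-- `U^{(R,β)}`: its columns are the coordinates of the right SOV states (with normalization
coefficients `c_n`) in the spin basis. -/
noncomputable def matUR (c : Fin N → ℂ) (β : ℂ) : Matrix (Fin (2 ^ N)) (Fin (2 ^ N)) ℂ :=
  Matrix.of fun i j => p.rightSOV c β ((kappa N).symm j) (spinPos ((kappa N).symm i))

end Params

end OpenXXZ

/-! In the variable x = λ - η/2 the boundary operator grows one site at a time, U_{N+1}(x) = R(x-ξ)
U_N(x) R(x+ξ), with the last site outermost (`opU_succ`), and it satisfies the reflection equation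
(`reflectionEq_opU`). The SOV states follow the same recursion. At x = -ξ the factor R(x+ξ) is sinh
η times a permutation, so that the operator A replaces the reference covector of the site by the
covector reflected through U_N(-ξ); the operator D does the same to vectors at x = ξ. For the other
sites, the exchange relations between gauge vectors and R, together with the reflection equation,
show that a further outer site only contributes a scalar. Hence the SOV states are explicit
multiples of `leftState` and `rightState` (`leftSOV_eq`, `rightSOV_eq`).

The pairing is computed by stripping the last site (`leftState_dotProduct_rightState_succ`). The
right gauge parameter is e^{2η} times the left one, which makes the two gauges at that site equal.
Different labels give zero, either because the gauge covector annihilates the gauge vector or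
because U(-ξ)U(ξ) is scalar. Equal labels leave a matrix element of the off-diagonal entry of the
gauged U_N at ±ξ. Left states are pseudo-eigenvectors of this entry (`offDiagMap_leftState`): the
labels are kept and the gauge is shifted by e^{-2η}, which restores the offset e^{2η} for the
shorter chain.

In the resulting product the labels enter only through pairs of sites, and each pair factor times
the difference of the η_a^{(h)} does not depend on the labels (`pairFactor_mul`). Setting all labels
to 1 identifies the constant with Z(β-2) (`normZ_eq`). Its possible zeros come from the gauged
boundary matrix, which factorizes (`gaugedK_exp`); away from them the two families are biorthogonal
bases and resolve the identity. -/

namespace OpenXXZ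

open scoped Kronecker

/-! ### Operators on two auxiliary spaces and a quantum space. -/

section TensorSpaces

set_option linter.unusedSectionVars false

variable {C : Type*} [Fintype C] [DecidableEq C]

theorem rMatrix_apply (η z : ℂ) (i s j t : Fin 2) :
    rMatrix η z (i, s) (j, t) =
      if i = s then (if j = i ∧ t = i then sinh (z + η) else 0)
      else if j = t then 0 else if i = j then sinh z else sinh η := by
  fin_cases i <;> fin_cases s <;> fin_cases j <;> fin_cases t <;>
    simp [rMatrix, finProdFinEquiv, Matrix.of_apply]

/-- The `R`-matrix acting on the first two factors of `ℂ² ⊗ ℂ² ⊗ ℂ^C`. -/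
noncomputable def rOn (C : Type*) [DecidableEq C] (η z : ℂ) :
    Matrix (Fin 2 × Fin 2 × C) (Fin 2 × Fin 2 × C) ℂ :=
  (rMatrix η z ⊗ₖ (1 : Matrix C C ℂ)).submatrix (Equiv.prodAssoc _ _ _).symm
    (Equiv.prodAssoc _ _ _).symm

/-- Exchange of the last two factors, with regrouping. -/
def spectatorEquiv (A B C : Type*) : A × B × C ≃ (A × C) × B where
  toFun s := ((s.1, s.2.2), s.2.1)
  invFun s := (s.1.1, s.2, s.1.2)
  left_inv _ := rfl
  right_inv _ := rfl

/-- An operator on `ℂ² ⊗ ℂ^C` acting on the first and third factors of `ℂ² ⊗ ℂ² ⊗ ℂ^C`. -/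
noncomputable def onFst (X : Matrix (Fin 2 × C) (Fin 2 × C) ℂ) :
    Matrix (Fin 2 × Fin 2 × C) (Fin 2 × Fin 2 × C) ℂ :=
  (X ⊗ₖ (1 : Matrix (Fin 2) (Fin 2) ℂ)).submatrix (spectatorEquiv _ _ _) (spectatorEquiv _ _ _)

/-- An operator on `ℂ² ⊗ ℂ^C` acting on the second and third factors of `ℂ² ⊗ ℂ² ⊗ ℂ^C`. -/
noncomputable def onSnd (X : Matrix (Fin 2 × C) (Fin 2 × C) ℂ) :
    Matrix (Fin 2 × Fin 2 × C) (Fin 2 × Fin 2 × C) ℂ :=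
  (1 : Matrix (Fin 2) (Fin 2) ℂ) ⊗ₖ X

theorem rOn_apply (η z : ℂ) (a i : Fin 2) (c : C) (b j : Fin 2) (d : C) :
    rOn C η z (a, i, c) (b, j, d) = if c = d then rMatrix η z (a, i) (b, j) else 0 := by
  simp [rOn, Matrix.one_apply]

theorem onFst_apply (X : Matrix (Fin 2 × C) (Fin 2 × C) ℂ) (a i : Fin 2) (c : C) (b j : Fin 2)
    (d : C) : onFst X (a, i, c) (b, j, d) = if i = j then X (a, c) (b, d) else 0 := by
  simp [onFst, Matrix.one_apply, spectatorEquiv]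

theorem onSnd_apply (X : Matrix (Fin 2 × C) (Fin 2 × C) ℂ) (a i : Fin 2) (c : C) (b j : Fin 2)
    (d : C) : onSnd X (a, i, c) (b, j, d) = if a = b then X (i, c) (j, d) else 0 := by
  simp [onSnd, Matrix.one_apply]

theorem onFst_mul (X Y : Matrix (Fin 2 × C) (Fin 2 × C) ℂ) :
    onFst (X * Y) = onFst X * onFst Y := by
  rw [onFst, onFst, onFst, submatrix_mul_equiv, ← mul_kronecker_mul, one_mul]

theorem onSnd_mul (X Y : Matrix (Fin 2 × C) (Fin 2 × C) ℂ) :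
    onSnd (X * Y) = onSnd X * onSnd Y := by
  rw [onSnd, onSnd, onSnd, ← mul_kronecker_mul, one_mul]

/-- The operator on `ℂ² ⊗ ℂ² ⊗ ℂ² ⊗ ℂ^C` that acts trivially on the third factor and as `X` on the
other ones. -/
noncomputable def insertThird (X : Matrix (Fin 2 × Fin 2 × C) (Fin 2 × Fin 2 × C) ℂ) :
    Matrix (Fin 2 × Fin 2 × Fin 2 × C) (Fin 2 × Fin 2 × Fin 2 × C) ℂ :=
  Matrix.of fun s t => if s.2.2.1 = t.2.2.1 then
    X (s.1, s.2.1, s.2.2.2) (t.1, t.2.1, t.2.2.2) else 0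

theorem insertThird_mul (X Y : Matrix (Fin 2 × Fin 2 × C) (Fin 2 × Fin 2 × C) ℂ) :
    insertThird (X * Y) = insertThird X * insertThird Y := by
  ext ⟨a, b, i, c⟩ ⟨a', b', i', c'⟩
  by_cases h : i = i' <;>
  simp [insertThird, Matrix.mul_apply, Fintype.sum_prod_type, h]

theorem insertThird_rOn (η z : ℂ) : insertThird (rOn C η z) = rOn (Fin 2 × C) η z := by
  ext ⟨a, b, i, c⟩ ⟨a', b', i', c'⟩
  simp only [insertThird, of_apply, rOn_apply, Prod.mk.injEq]
  split_ifs <;> simp_all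

theorem insertThird_onFst (X : Matrix (Fin 2 × C) (Fin 2 × C) ℂ) :
    insertThird (onFst X) = onFst (onFst X) := by
  ext ⟨a, b, i, c⟩ ⟨a', b', i', c'⟩
  simp only [insertThird, of_apply, onFst_apply]
  split_ifs <;> simp_all

theorem insertThird_onSnd (X : Matrix (Fin 2 × C) (Fin 2 × C) ℂ) :
    insertThird (onSnd X) = onSnd (onFst X) := by
  ext ⟨a, b, i, c⟩ ⟨a', b', i', c'⟩
  simp only [insertThird, of_apply, onFst_apply, onSnd_apply]
  split_ifs <;> simp_all

theorem onFst_onFst_comm (X : Matrix (Fin 2 × C) (Fin 2 × C) ℂ) (η z : ℂ) :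
    onFst (onFst X) * onSnd (rOn C η z) = onSnd (rOn C η z) * onFst (onFst X) := by
  ext ⟨a, b, i, c⟩ ⟨a', b', i', c'⟩
  simp [Matrix.mul_apply, Fintype.sum_prod_type, onFst_apply, onSnd_apply, rOn_apply, mul_comm]

theorem onSnd_onFst_comm (X : Matrix (Fin 2 × C) (Fin 2 × C) ℂ) (η z : ℂ) :
    onSnd (onFst X) * onFst (rOn C η z) = onFst (rOn C η z) * onSnd (onFst X) := by
  ext ⟨a, b, i, c⟩ ⟨a', b', i', c'⟩
  simp [Matrix.mul_apply, Fintype.sum_prod_type, onFst_apply, onSnd_apply, rOn_apply, mul_comm]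

end TensorSpaces

/-! ### Yang-Baxter equation, reflection equation and its stability under dressing. -/

section Reflection

set_option linter.unusedSectionVars false

variable {C : Type*} [Fintype C] [DecidableEq C]

-- With the values of sinh treated as independent letters, every component is either trivial or sinh
-- η times one of the three addition identities `e1`, `e2`, `e3`.
set_option maxHeartbeats 1000000 in
theorem yangBaxter_scalar (η u v : ℂ) (a b i a' b' i' : Fin 2) :
    ∑ e : Fin 2, ∑ f : Fin 2, ∑ g : Fin 2, rMatrix η u (a, b) (e, f) *
        (rMatrix η (u + v) (e, i) (a', g) * rMatrix η v (f, g) (b', i')) =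
      ∑ f : Fin 2, ∑ g : Fin 2, ∑ e : Fin 2, rMatrix η v (b, i) (f, g) *
        (rMatrix η (u + v) (a, g) (e, i') * rMatrix η u (e, f) (a', b')) := by
  have e1 : sinh (u + η) * sinh (u + v) = sinh (u + v + η) * sinh u + sinh v * sinh η := by
    simp only [sinh, exp_add, exp_neg, neg_add]
    field_simp
    ring
  have e2 : sinh (u + η) * sinh (v + η) = sinh (u + v + η) * sinh η + sinh v * sinh u := by
    simp only [sinh, exp_add, exp_neg, neg_add]
    field_simp
    ring
  have e3 : sinh (v + η) * sinh (u + v) = sinh u * sinh η + sinh (u + v + η) * sinh v := by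
    simp only [sinh, exp_add, exp_neg, neg_add]
    field_simp
    ring
  generalize ha : sinh (u + η) = A at e1 e2 e3 ⊢
  generalize hb : sinh u = B at e1 e2 e3 ⊢
  generalize hc : sinh (u + v + η) = A' at e1 e2 e3 ⊢
  generalize hd : sinh (u + v) = B' at e1 e2 e3 ⊢
  generalize he : sinh (v + η) = A'' at e1 e2 e3 ⊢
  generalize hf : sinh v = B'' at e1 e2 e3 ⊢
  generalize hg : sinh η = D at e1 e2 e3 ⊢
  fin_cases a <;> fin_cases b <;> fin_cases i <;> fin_cases a' <;> fin_cases b' <;>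
    fin_cases i' <;> simp [rMatrix_apply, Fin.sum_univ_two, ha, hb, hc, hd, he, hf, hg] <;>
    first
    | ring1
    | linear_combination D * e1
    | linear_combination D * e2
    | linear_combination D * e3
    | linear_combination -D * e1
    | linear_combination -D * e2
    | linear_combination -D * e3
theorem rMatrix_swap (η z : ℂ) (i s j t : Fin 2) :
    rMatrix η z (i, s) (j, t) = rMatrix η z (s, i) (t, j) := by
  fin_cases i <;> fin_cases s <;> fin_cases j <;> fin_cases t <;> simp [rMatrix_apply]

theorem yangBaxter (η u v : ℂ) :
    rOn (Fin 2 × C) η u * (onFst (rOn C η (u + v)) * onSnd (rOn C η v)) =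
      onSnd (rOn C η v) * (onFst (rOn C η (u + v)) * rOn (Fin 2 × C) η u) := by
  ext ⟨a, b, i, c⟩ ⟨a', b', i', c'⟩
  have key := yangBaxter_scalar η u v a b i a' b' i'
  by_cases h : c = c'
  · subst h
    simp only [Matrix.mul_apply, Fintype.sum_prod_type, onFst_apply, onSnd_apply, rOn_apply,
      mul_ite, ite_mul, mul_zero, zero_mul, Finset.sum_ite_eq,
      Finset.sum_ite_eq', Finset.sum_ite_irrel, Finset.sum_const_zero, Finset.mem_univ, if_true,
      Finset.mul_sum]
    exact key
  · simp only [Matrix.mul_apply, Fintype.sum_prod_type, onFst_apply, onSnd_apply, rOn_apply,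
      mul_ite, ite_mul, mul_zero, zero_mul, Finset.sum_ite_eq,
      Finset.sum_ite_eq', Finset.sum_ite_irrel, Finset.sum_const_zero, Finset.mem_univ, if_true,
      Finset.mul_sum, h, if_false]

theorem yangBaxter' (η u v : ℂ) :
    onFst (rOn C η u) * (rOn (Fin 2 × C) η (u + v) * onSnd (rOn C η v)) =
      onSnd (rOn C η v) * (rOn (Fin 2 × C) η (u + v) * onFst (rOn C η u)) := by
  ext ⟨a, b, i, c⟩ ⟨a', b', i', c'⟩
  have key := yangBaxter_scalar η u v a i b a' i' b'
  by_cases h : c = c'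
  · subst h
    simp only [Matrix.mul_apply, Fintype.sum_prod_type, onFst_apply, onSnd_apply, rOn_apply,
      Prod.mk.injEq, ite_and, mul_ite, ite_mul, mul_zero, zero_mul, Finset.sum_ite_eq,
      Finset.sum_ite_eq', Finset.sum_ite_irrel, Finset.sum_const_zero, Finset.mem_univ, if_true,
      Finset.mul_sum]
    -- R is invariant under exchange of its two factors, so this is the scalar identity with the
    -- second auxiliary space and the site interchanged.
    simp only [rMatrix_swap η v b i, fun f g => rMatrix_swap η v g f b' i']
    exact key.trans Finset.sum_comm
  · simp only [Matrix.mul_apply, Fintype.sum_prod_type, onFst_apply, onSnd_apply, rOn_apply,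
      Prod.mk.injEq, ite_and, mul_ite, ite_mul, mul_zero, zero_mul, Finset.sum_ite_eq,
      Finset.sum_ite_eq', Finset.sum_ite_irrel, Finset.sum_const_zero, Finset.mem_univ, if_true,
      Finset.mul_sum, h, if_false]

/-- The reflection equation. -/
def ReflectionEq (η : ℂ) (U : ℂ → Matrix (Fin 2 × C) (Fin 2 × C) ℂ) : Prop :=
  ∀ x y, rOn C η (x - y) * onFst (U x) * rOn C η (x + y) * onSnd (U y) =
    onSnd (U y) * rOn C η (x + y) * onFst (U x) * rOn C η (x - y)

/-- Dressing of a boundary operator by a site with inhomogeneity `ξ`. -/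
noncomputable def dress (η ξ : ℂ) (U : ℂ → Matrix (Fin 2 × C) (Fin 2 × C) ℂ) (x : ℂ) :
    Matrix (Fin 2 × Fin 2 × C) (Fin 2 × Fin 2 × C) ℂ :=
  rOn C η (x - ξ) * onFst (U x) * rOn C η (x + ξ)

/-- Sklyanin's argument: four Yang-Baxter moves carry the R-matrices of the new site past those of
the two auxiliary spaces, and the reflection equation of the undressed operator is used once in the
middle. -/
theorem ReflectionEq.dress {η : ℂ} {U : ℂ → Matrix (Fin 2 × C) (Fin 2 × C) ℂ}
    (hU : ReflectionEq η U) (ξ : ℂ) : ReflectionEq η (dress η ξ U) := by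
  intro x y
  simp only [OpenXXZ.dress, onFst_mul, onSnd_mul]
  -- The undressed equation does not see the new site, hence is tensored with the identity there.
  have hre := congrArg insertThird (hU x y)
  simp only [insertThird_mul, insertThird_rOn, insertThird_onFst, insertThird_onSnd] at hre
  have y1 := yangBaxter' (C := C) η (x + ξ) (y - ξ)
  have y2 := yangBaxter (C := C) η (x - y) (y - ξ)
  have y3 := yangBaxter (C := C) η (x - y) (y + ξ)
  have y4 := yangBaxter' (C := C) η (x - ξ) (y + ξ)
  have c1 := onFst_onFst_comm (U x) η (y - ξ)
  have c2 := onFst_onFst_comm (U x) η (y + ξ)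
  have c3 := onSnd_onFst_comm (U y) η (x - ξ)
  have c4 := onSnd_onFst_comm (U y) η (x + ξ)
  rw [show x + ξ + (y - ξ) = x + y by ring] at y1
  rw [show x - y + (y - ξ) = x - ξ by ring] at y2
  rw [show x - y + (y + ξ) = x + ξ by ring] at y3
  rw [show x - ξ + (y + ξ) = x + y by ring] at y4
  generalize onFst (onFst (U x)) = U₁ at *
  generalize onSnd (onFst (U y)) = U₂ at *
  generalize rOn (Fin 2 × C) η (x - y) = r at *
  generalize rOn (Fin 2 × C) η (x + y) = r' at *
  generalize onFst (rOn C η (x - ξ)) = s at *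
  generalize onFst (rOn C η (x + ξ)) = s' at *
  generalize onSnd (rOn C η (y - ξ)) = t at *
  generalize onSnd (rOn C η (y + ξ)) = t' at *
  calc r * (s * U₁ * s') * r' * (t * U₂ * t')
      = r * s * U₁ * (s' * (r' * t)) * U₂ * t' := by simp only [Matrix.mul_assoc]
    _ = r * s * (U₁ * t) * r' * (s' * U₂) * t' := by rw [y1]; simp only [Matrix.mul_assoc]
    _ = r * (s * t) * U₁ * r' * U₂ * (s' * t') := by
      rw [c1, ← c4]; simp only [Matrix.mul_assoc]
    _ = t * s * (r * U₁ * r' * U₂) * (s' * t') := by rw [y2]; simp only [Matrix.mul_assoc]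
    _ = t * (s * U₂) * r' * U₁ * (r * (s' * t')) := by rw [hre]; simp only [Matrix.mul_assoc]
    _ = t * U₂ * s * r' * (U₁ * t') * s' * r := by
      rw [y3, ← c3]; simp only [Matrix.mul_assoc]
    _ = t * U₂ * (s * (r' * t')) * U₁ * s' * r := by rw [c2]; simp only [Matrix.mul_assoc]
    _ = t * U₂ * t' * r' * (s * U₁ * s') * r := by rw [y4]; simp only [Matrix.mul_assoc]

end Reflection

/-! ### Gauge vectors and their exchange relations with R. -/

section GaugeVectors

set_option linter.unusedSectionVars false

variable {C : Type*} [Fintype C] [DecidableEq C]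

/-- The gauge covector `(1, -e^{-x} u)`. -/
noncomputable def rowVec (u x : ℂ) : Fin 2 → ℂ := ![1, -(exp (-x) * u)]

/-- The gauge vector `(e^{-x} v, 1)`, annihilated by the covector with the same parameters. -/
noncomputable def colVec (v x : ℂ) : Fin 2 → ℂ := ![exp (-x) * v, 1]

/-- The product vector `v ⊗ ψ`. -/
def tens (v : Fin 2 → ℂ) (ψ : C → ℂ) : Fin 2 × C → ℂ := fun s => v s.1 * ψ s.2

/-- The vector of `ℂ² ⊗ ℂ² ⊗ ℂ^C` that is `w` in the second factor and `φ` in the other two. -/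
def midTens (φ : Fin 2 × C → ℂ) (w : Fin 2 → ℂ) : Fin 2 × Fin 2 × C → ℂ :=
  fun s => w s.2.1 * φ (s.1, s.2.2)

/-- Contraction of the first factor with the vector `v`. -/
def contr {D : Type*} (v : Fin 2 → ℂ) (φ : Fin 2 × D → ℂ) : D → ℂ := fun c => ∑ a, v a * φ (a, c)

theorem rowVec_dotProduct_colVec (u x : ℂ) : rowVec u x ⬝ᵥ colVec u x = 0 := by
  simp [rowVec, colVec]

theorem tens_tens_eq_midTens (y w : Fin 2 → ℂ) (ψ : C → ℂ) :
    tens y (tens w ψ) = midTens (tens y ψ) w := by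
  ext s
  simp only [tens, midTens]
  ring

theorem tens_smul (v : Fin 2 → ℂ) (c : ℂ) (ψ : C → ℂ) : tens v (c • ψ) = c • tens v ψ := by
  ext s
  simp only [tens, Pi.smul_apply, smul_eq_mul]
  ring

theorem smul_tens (v : Fin 2 → ℂ) (c : ℂ) (ψ : C → ℂ) : tens (c • v) ψ = c • tens v ψ := by
  ext s
  simp only [tens, Pi.smul_apply, smul_eq_mul]
  ring

theorem contr_smul {D : Type*} (v : Fin 2 → ℂ) (c : ℂ) (φ : Fin 2 × D → ℂ) :
    contr v (c • φ) = c • contr v φ := by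
  ext s
  simp only [contr, Pi.smul_apply, smul_eq_mul, Finset.mul_sum]
  exact Finset.sum_congr rfl fun _ _ => by ring

theorem contr_tens (v w : Fin 2 → ℂ) (ψ : C → ℂ) : contr v (tens w ψ) = (w ⬝ᵥ v) • ψ := by
  ext s
  simp only [contr, tens, Pi.smul_apply, smul_eq_mul, dotProduct, Finset.sum_mul]
  exact Finset.sum_congr rfl fun _ _ => by ring

theorem dotProduct_tens (φ : Fin 2 × C → ℂ) (v : Fin 2 → ℂ) (ψ : C → ℂ) :
    φ ⬝ᵥ tens v ψ = contr v φ ⬝ᵥ ψ := by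
  simp only [dotProduct, tens, contr, Fintype.sum_prod_type, Finset.sum_mul]
  rw [Finset.sum_comm]
  exact Finset.sum_congr rfl fun _ _ => Finset.sum_congr rfl fun _ _ => by ring

theorem midTens_vecMul_onFst (φ : Fin 2 × C → ℂ) (w : Fin 2 → ℂ)
    (X : Matrix (Fin 2 × C) (Fin 2 × C) ℂ) :
    midTens φ w ᵥ* onFst X = midTens (φ ᵥ* X) w := by
  ext ⟨a, i, c⟩
  simp only [midTens, vecMul, dotProduct, onFst_apply, Fintype.sum_prod_type, mul_ite, mul_zero,
    Finset.sum_ite_irrel, Finset.sum_const_zero, Finset.sum_ite_eq', Finset.mem_univ, if_true,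
    Finset.mul_sum, mul_assoc]

theorem tens_vecMul_onSnd (v : Fin 2 → ℂ) (φ : Fin 2 × C → ℂ)
    (X : Matrix (Fin 2 × C) (Fin 2 × C) ℂ) : tens v φ ᵥ* onSnd X = tens v (φ ᵥ* X) := by
  ext ⟨a, i, c⟩
  simp only [tens, vecMul, dotProduct, onSnd_apply, Fintype.sum_prod_type, mul_ite, mul_zero,
    Finset.sum_ite_irrel, Finset.sum_const_zero, Finset.sum_ite_eq', Finset.mem_univ, if_true,
    Finset.mul_sum, mul_assoc]

theorem contr_vecMul_onSnd (v : Fin 2 → ℂ) (Φ : Fin 2 × Fin 2 × C → ℂ)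
    (X : Matrix (Fin 2 × C) (Fin 2 × C) ℂ) : contr v (Φ ᵥ* onSnd X) = contr v Φ ᵥ* X := by
  ext ⟨i, c⟩
  simp only [contr, vecMul, dotProduct, onSnd_apply, Fintype.sum_prod_type, Fin.sum_univ_two,
    mul_ite, mul_zero, Finset.mul_sum, add_mul, Finset.sum_add_distrib, mul_add, mul_assoc]
  simp
  ring

theorem onFst_mulVec_midTens (φ : Fin 2 × C → ℂ) (w : Fin 2 → ℂ)
    (X : Matrix (Fin 2 × C) (Fin 2 × C) ℂ) :
    onFst X *ᵥ midTens φ w = midTens (X *ᵥ φ) w := by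
  have h : (onFst X)ᵀ = onFst Xᵀ := by
    ext ⟨a, i, c⟩ ⟨b, j, d⟩
    simp [onFst_apply, eq_comm]
  rw [← vecMul_transpose, h, midTens_vecMul_onFst, vecMul_transpose]

theorem onSnd_mulVec_tens (v : Fin 2 → ℂ) (φ : Fin 2 × C → ℂ)
    (X : Matrix (Fin 2 × C) (Fin 2 × C) ℂ) : onSnd X *ᵥ tens v φ = tens v (X *ᵥ φ) := by
  have h : (onSnd X)ᵀ = onSnd Xᵀ := by
    ext ⟨a, i, c⟩ ⟨b, j, d⟩
    simp [onSnd_apply, eq_comm]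
  rw [← vecMul_transpose, h, tens_vecMul_onSnd, vecMul_transpose]

theorem vecMul_rOn_apply (f : Fin 2 × Fin 2 × C → ℂ) (η z : ℂ) (b j : Fin 2) (c : C) :
    (f ᵥ* rOn C η z) (b, j, c) = ∑ a, ∑ i, f (a, i, c) * rMatrix η z (a, i) (b, j) := by
  simp [vecMul, dotProduct, rOn_apply, Fintype.sum_prod_type]

theorem rOn_transpose (η z : ℂ) : (rOn C η z)ᵀ = rOn C η z := by
  ext ⟨a, i, c⟩ ⟨b, j, d⟩
  fin_cases a <;> fin_cases i <;> fin_cases b <;> fin_cases j <;>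
    simp [rOn_apply, rMatrix_apply, eq_comm]

/-- Vertex-face exchange: when the gauge parameters of the two factors differ by e^η, R interchanges
these parameters and leaves the spectral ones in place. The three relations that follow are the
other order and the analogues for vectors. -/
theorem rowVec_vecMul_rOn (η u x y : ℂ) (ψ : C → ℂ) :
    tens (rowVec u x) (tens (rowVec (u * exp η) y) ψ) ᵥ* rOn C η (x - y) =
      sinh (x - y + η) • tens (rowVec (u * exp η) x) (tens (rowVec u y) ψ) := by
  ext ⟨b, j, c⟩
  rw [vecMul_rOn_apply]
  fin_cases b <;> fin_cases j <;>
    simp [Fin.sum_univ_two, tens, rowVec, rMatrix_apply, sinh, sub_eq_add_neg, exp_add, exp_neg] <;> field_simp <;> ring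

theorem rowVec_vecMul_rOn' (η u x y : ℂ) (ψ : C → ℂ) :
    tens (rowVec (u * exp η) x) (tens (rowVec u y) ψ) ᵥ* rOn C η (y - x) =
      sinh (y - x + η) • tens (rowVec u x) (tens (rowVec (u * exp η) y) ψ) := by
  ext ⟨b, j, c⟩
  rw [vecMul_rOn_apply]
  fin_cases b <;> fin_cases j <;>
    simp [Fin.sum_univ_two, tens, rowVec, rMatrix_apply, sinh, sub_eq_add_neg, exp_add, exp_neg] <;> field_simp <;> ring

theorem rOn_mulVec_colVec (η p x y : ℂ) (φ : C → ℂ) :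
    rOn C η (x - y) *ᵥ tens (colVec p x) (tens (colVec (p * exp η) y) φ) =
      sinh (x - y + η) • tens (colVec (p * exp η) x) (tens (colVec p y) φ) := by
  rw [← vecMul_transpose, rOn_transpose]
  ext ⟨b, j, c⟩
  rw [vecMul_rOn_apply]
  fin_cases b <;> fin_cases j <;>
    simp [Fin.sum_univ_two, tens, colVec, rMatrix_apply, sinh, sub_eq_add_neg, exp_add, exp_neg] <;> field_simp <;> ring

theorem rOn_mulVec_colVec' (η p x y : ℂ) (φ : C → ℂ) :
    rOn C η (y - x) *ᵥ tens (colVec (p * exp η) x) (tens (colVec p y) φ) =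
      sinh (y - x + η) • tens (colVec p x) (tens (colVec (p * exp η) y) φ) := by
  rw [← vecMul_transpose, rOn_transpose]
  ext ⟨b, j, c⟩
  rw [vecMul_rOn_apply]
  fin_cases b <;> fin_cases j <;>
    simp [Fin.sum_univ_two, tens, colVec, rMatrix_apply, sinh, sub_eq_add_neg, exp_add, exp_neg] <;> field_simp <;> ring

/-- The contraction passes through R for arbitrary `φ`, without any other matrix element appearing.
This is why the off-diagonal entry of a dressed operator involves only the off-diagonal entry of the
undressed one. -/
theorem contr_midTens_vecMul_rOn (η w x y : ℂ) (φ : Fin 2 × C → ℂ) :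
    contr (colVec w x) (midTens φ (rowVec w y) ᵥ* rOn C η (y - x)) =
      sinh (y - x) • tens (rowVec (w * exp (-η)) y) (contr (colVec (w * exp η) x) φ) := by
  ext ⟨j, c⟩
  simp only [contr, vecMul_rOn_apply]
  fin_cases j <;>
    simp [Fin.sum_univ_two, tens, contr, midTens, rowVec, colVec, rMatrix_apply, sinh,
      sub_eq_add_neg, exp_add, exp_neg] <;> field_simp <;> ring

/-- R(0) is sinh η times the permutation of the auxiliary space and the site. -/
theorem midTens_vecMul_rOn_zero (η : ℂ) (w : Fin 2 → ℂ) (φ : Fin 2 × C → ℂ) :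
    midTens φ w ᵥ* rOn C η 0 = sinh η • tens w φ := by
  ext ⟨b, j, c⟩
  rw [vecMul_rOn_apply]
  fin_cases b <;> fin_cases j <;>
    simp [Fin.sum_univ_two, midTens, tens, rMatrix_apply] <;> ring

theorem rOn_zero_mulVec_midTens (η : ℂ) (w : Fin 2 → ℂ) (φ : Fin 2 × C → ℂ) :
    rOn C η 0 *ᵥ midTens φ w = sinh η • tens w φ := by
  rw [← vecMul_transpose, rOn_transpose]
  exact midTens_vecMul_rOn_zero η w φ

end GaugeVectors

/-! ### Effect of one additional site on actions and pairings. -/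

section Steps

set_option linter.unusedSectionVars false

variable {C : Type*} [Fintype C] [DecidableEq C]

/-- The covector `ψ` is mapped to `ψ'` by the first row of `U(x)` in the gauge `u`, the other
entry of that row (the one in the direction of `colVec u (-x)`) annihilating `ψ`. -/
def RowMap (U : ℂ → Matrix (Fin 2 × C) (Fin 2 × C) ℂ) (u x : ℂ) (ψ ψ' : C → ℂ) : Prop :=
  tens (rowVec u x) ψ ᵥ* U x = tens (rowVec u (-x)) ψ'

/-- The vector `φ` is mapped to `φ'` by the second column of `U(x)` in the gauge `p`. -/
def ColMap (U : ℂ → Matrix (Fin 2 × C) (Fin 2 × C) ℂ) (p x : ℂ) (φ φ' : C → ℂ) : Prop :=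
  U x *ᵥ tens (colVec p (-x)) φ = tens (colVec p x) φ'

/-- `ψ ↦ ψ'` under the off-diagonal entry of `U(x)` in the gauge `u`. -/
def OffDiagMap (U : ℂ → Matrix (Fin 2 × C) (Fin 2 × C) ℂ) (u x : ℂ) (ψ ψ' : C → ℂ) : Prop :=
  contr (colVec u (-x)) (tens (rowVec u x) ψ ᵥ* U x) = ψ'

/-- The covector of the dressed chain with the new site in its reference state. -/
noncomputable def leftExt (u ξ : ℂ) (ψ : C → ℂ) : Fin 2 × C → ℂ := tens (rowVec u ξ) ψ

/-- The covector of the dressed chain with the new site reflected. -/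
noncomputable def leftRefl (U : ℂ → Matrix (Fin 2 × C) (Fin 2 × C) ℂ) (u ξ : ℂ) (ψ : C → ℂ) :
    Fin 2 × C → ℂ := tens (rowVec u (-ξ)) ψ ᵥ* U (-ξ)

/-- The vector of the dressed chain with the new site in its reference state. -/
noncomputable def rightExt (p ξ : ℂ) (φ : C → ℂ) : Fin 2 × C → ℂ := tens (colVec p ξ) φ

/-- The vector of the dressed chain with the new site reflected. -/
noncomputable def rightRefl (U : ℂ → Matrix (Fin 2 × C) (Fin 2 × C) ℂ) (p ξ : ℂ) (φ : C → ℂ) :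
    Fin 2 × C → ℂ := U ξ *ᵥ tens (colVec p (-ξ)) φ

variable {η : ℂ} {U : ℂ → Matrix (Fin 2 × C) (Fin 2 × C) ℂ} {ψ ψ' : C → ℂ} {u x : ℂ} (ξ : ℂ)

theorem RowMap.leftExt (h : RowMap U (u * exp η) x ψ ψ') :
    RowMap (dress η ξ U) u x (leftExt (u * exp η) ξ ψ)
      ((sinh (x - ξ + η) * sinh (x + ξ + η)) • OpenXXZ.leftExt (u * exp η) ξ ψ') := by
  unfold RowMap at h ⊢
  have h3 := rowVec_vecMul_rOn' η u (-x) ξ ψ'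
  rw [show ξ - -x = x + ξ by ring] at h3
  rw [OpenXXZ.leftExt, OpenXXZ.leftExt, dress, ← vecMul_vecMul, ← vecMul_vecMul,
    rowVec_vecMul_rOn, smul_vecMul, tens_tens_eq_midTens, midTens_vecMul_onFst, h,
    ← tens_tens_eq_midTens, smul_vecMul, h3, tens_smul, smul_smul]

/-- No information on U is needed: at x = -ξ the right R-matrix is R(0), which exchanges the
auxiliary space with the site and so deposits the covector reflected by U on the site. -/
theorem rowMap_leftExt_new (u : ℂ) (ψ : C → ℂ) :
    RowMap (dress η ξ U) u (-ξ) (leftExt (u * exp η) ξ ψ)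
      ((sinh η * sinh (η - 2 * ξ)) • leftRefl U (u * exp η) ξ ψ) := by
  unfold RowMap
  have h1 := rowVec_vecMul_rOn η u (-ξ) ξ ψ
  rw [leftExt, dress, ← vecMul_vecMul, ← vecMul_vecMul, h1, smul_vecMul, tens_tens_eq_midTens,
    midTens_vecMul_onFst, smul_vecMul, neg_add_cancel, midTens_vecMul_rOn_zero, tens_smul,
    smul_smul, leftRefl, neg_neg, show -ξ - ξ + η = η - 2 * ξ by ring, mul_comm]

/-- The reflection equation at y = -ξ moves U(-ξ) to the right of the dressed operator and turns it
into R(x+ξ) U(x) R(x-ξ). A reflected site thus behaves like a reference site with -ξ in place of ξ.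
-/
theorem RowMap.leftRefl (hU : ReflectionEq η U) (h : RowMap U (u * exp η) x ψ ψ') :
    RowMap (dress η ξ U) u x (leftRefl U (u * exp η) ξ ψ)
      ((sinh (x - ξ + η) * sinh (x + ξ + η)) • OpenXXZ.leftRefl U (u * exp η) ξ ψ') := by
  unfold RowMap at h ⊢
  have hre := hU x (-ξ)
  rw [sub_neg_eq_add, ← sub_eq_add_neg] at hre
  have h1 := rowVec_vecMul_rOn η u x (-ξ) ψ
  have h3 := rowVec_vecMul_rOn' η u (-x) (-ξ) ψ'
  rw [show -ξ - -x = x - ξ by ring] at h3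
  rw [sub_neg_eq_add] at h1
  rw [OpenXXZ.leftRefl, OpenXXZ.leftRefl, dress, ← tens_vecMul_onSnd, vecMul_vecMul,
    ← Matrix.mul_assoc, ← Matrix.mul_assoc, ← hre, ← vecMul_vecMul, ← vecMul_vecMul,
    ← vecMul_vecMul, h1, smul_vecMul, tens_tens_eq_midTens, midTens_vecMul_onFst, h,
    ← tens_tens_eq_midTens, smul_vecMul, h3, smul_vecMul, smul_vecMul, tens_vecMul_onSnd,
    tens_smul, smul_smul, mul_comm]

/-- The left R-matrix raises the auxiliary gauge to u e^η and the contraction matches it there; the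
site is left with gauge u e^{-η}, the source of the total shift by e^{-2η}. -/
theorem OffDiagMap.leftExt (h : OffDiagMap U (u * exp η) x ψ ψ') :
    OffDiagMap (dress η ξ U) u x (leftExt (u * exp η) ξ ψ)
      ((sinh (x - ξ + η) * sinh (x + ξ)) • OpenXXZ.leftExt (u * exp (-η)) ξ ψ') := by
  unfold OffDiagMap at h ⊢
  have h2 := contr_midTens_vecMul_rOn η u (-x) ξ (tens (rowVec (u * exp η) x) ψ ᵥ* U x)
  rw [show ξ - -x = x + ξ by ring, h] at h2
  rw [OpenXXZ.leftExt, OpenXXZ.leftExt, dress, ← vecMul_vecMul, ← vecMul_vecMul,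
    rowVec_vecMul_rOn, smul_vecMul, tens_tens_eq_midTens, midTens_vecMul_onFst, smul_vecMul,
    contr_smul, h2, smul_smul]

theorem OffDiagMap.leftRefl (hU : ReflectionEq η U) (h : OffDiagMap U (u * exp η) x ψ ψ') :
    OffDiagMap (dress η ξ U) u x (leftRefl U (u * exp η) ξ ψ)
      ((sinh (x + ξ + η) * sinh (x - ξ)) • OpenXXZ.leftRefl U (u * exp (-η)) ξ ψ') := by
  unfold OffDiagMap at h ⊢
  have hre := hU x (-ξ)
  rw [sub_neg_eq_add, ← sub_eq_add_neg] at hre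
  have h1 := rowVec_vecMul_rOn η u x (-ξ) ψ
  rw [sub_neg_eq_add] at h1
  have h2 := contr_midTens_vecMul_rOn η u (-x) (-ξ) (tens (rowVec (u * exp η) x) ψ ᵥ* U x)
  rw [show -ξ - -x = x - ξ by ring, h] at h2
  rw [OpenXXZ.leftRefl, OpenXXZ.leftRefl, dress, ← tens_vecMul_onSnd, vecMul_vecMul,
    ← Matrix.mul_assoc, ← Matrix.mul_assoc, ← hre, ← vecMul_vecMul, ← vecMul_vecMul,
    ← vecMul_vecMul, h1, smul_vecMul, tens_tens_eq_midTens, midTens_vecMul_onFst, smul_vecMul,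
    smul_vecMul, contr_smul, contr_vecMul_onSnd, h2, smul_vecMul, smul_smul]

variable {φ φ' : C → ℂ} {p : ℂ}

theorem ColMap.rightExt (h : ColMap U p x φ φ') :
    ColMap (dress η ξ U) (p * exp η) x (rightExt p ξ φ)
      ((sinh (x - ξ + η) * sinh (x + ξ + η)) • OpenXXZ.rightExt p ξ φ') := by
  unfold ColMap at h ⊢
  have h1 := rOn_mulVec_colVec' η p (-x) ξ φ
  rw [show ξ - -x = x + ξ by ring] at h1
  rw [OpenXXZ.rightExt, OpenXXZ.rightExt, dress, ← mulVec_mulVec, ← mulVec_mulVec, h1,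
    mulVec_smul, tens_tens_eq_midTens, onFst_mulVec_midTens, h, ← tens_tens_eq_midTens,
    mulVec_smul, rOn_mulVec_colVec, tens_smul, smul_smul, mul_comm]

theorem colMap_rightExt_new (p : ℂ) (φ : C → ℂ) :
    ColMap (dress η ξ U) (p * exp η) ξ (rightExt p ξ φ)
      ((sinh η * sinh (2 * ξ + η)) • rightRefl U p ξ φ) := by
  unfold ColMap
  have h1 := rOn_mulVec_colVec' η p (-ξ) ξ φ
  rw [sub_neg_eq_add] at h1
  rw [rightExt, dress, ← mulVec_mulVec, ← mulVec_mulVec, h1, mulVec_smul, tens_tens_eq_midTens,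
    onFst_mulVec_midTens, mulVec_smul, sub_self, rOn_zero_mulVec_midTens, tens_smul, smul_smul,
    rightRefl, two_mul, mul_comm]

theorem ColMap.rightRefl (hU : ReflectionEq η U) (h : ColMap U p x φ φ') :
    ColMap (dress η ξ U) (p * exp η) x (rightRefl U p ξ φ)
      ((sinh (x - ξ + η) * sinh (x + ξ + η)) • OpenXXZ.rightRefl U p ξ φ') := by
  unfold ColMap at h ⊢
  have hre := hU x ξ
  have h1 := rOn_mulVec_colVec' η p (-x) (-ξ) φ
  rw [show -ξ - -x = x - ξ by ring] at h1
  have h3 := rOn_mulVec_colVec η p x (-ξ) φ'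
  rw [sub_neg_eq_add] at h3
  rw [OpenXXZ.rightRefl, OpenXXZ.rightRefl, dress, ← onSnd_mulVec_tens, mulVec_mulVec, hre,
    ← mulVec_mulVec, ← mulVec_mulVec, ← mulVec_mulVec, h1, mulVec_smul, tens_tens_eq_midTens,
    onFst_mulVec_midTens, h, ← tens_tens_eq_midTens, mulVec_smul, h3, mulVec_smul, mulVec_smul,
    onSnd_mulVec_tens, tens_smul, smul_smul]

theorem leftExt_dotProduct_rightExt (u : ℂ) : leftExt u ξ ψ ⬝ᵥ rightExt u ξ φ = 0 := by
  rw [leftExt, rightExt, dotProduct_tens, contr_tens, rowVec_dotProduct_colVec, zero_smul,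
    zero_dotProduct]

theorem leftRefl_dotProduct_rightExt (h : OffDiagMap U u (-ξ) ψ ψ') :
    leftRefl U u ξ ψ ⬝ᵥ rightExt u ξ φ = ψ' ⬝ᵥ φ := by
  unfold OffDiagMap at h
  rw [neg_neg] at h
  rw [leftRefl, rightExt, dotProduct_tens, h]

theorem leftExt_dotProduct_rightRefl (h : OffDiagMap U u ξ ψ ψ') :
    leftExt u ξ ψ ⬝ᵥ rightRefl U u ξ φ = ψ' ⬝ᵥ φ := by
  unfold OffDiagMap at h
  rw [leftExt, rightRefl, dotProduct_mulVec, dotProduct_tens, h]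

/-- The two reflections cancel up to a scalar, leaving a gauge covector against the vector it
annihilates, both with spectral parameter -ξ. -/
theorem leftRefl_dotProduct_rightRefl {c : ℂ} (h : U (-ξ) * U ξ = c • 1) (u : ℂ) :
    leftRefl U u ξ ψ ⬝ᵥ rightRefl U u ξ φ = 0 := by
  rw [leftRefl, rightRefl, dotProduct_mulVec, vecMul_vecMul, h, vecMul_smul, vecMul_one,
    dotProduct_tens, contr_smul, contr_tens, rowVec_dotProduct_colVec, zero_smul, smul_zero,
    zero_dotProduct]

theorem rOn_mul_rOn_neg (η z : ℂ) :
    ∃ c : ℂ, rOn C η z * rOn C η (-z) = c • 1 := by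
  refine ⟨sinh η ^ 2 - sinh z ^ 2, ?_⟩
  have h : sinh (z + η) * sinh (-z + η) = sinh η ^ 2 - sinh z ^ 2 := by
    simp only [sinh, exp_add, exp_neg, neg_add, neg_neg]
    field_simp
    ring
  ext ⟨a, i, c⟩ ⟨b, j, d⟩
  simp only [Matrix.mul_apply, Fintype.sum_prod_type, rOn_apply, Fin.sum_univ_two, ite_mul,
    zero_mul, mul_ite, mul_zero,
    Matrix.smul_apply, Matrix.one_apply, Prod.mk.injEq, smul_eq_mul]
  by_cases hcd : c = d
  · fin_cases a <;> fin_cases i <;> fin_cases b <;> fin_cases j <;>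
      simp [rMatrix_apply, h, hcd] <;> ring
  · simp [hcd]

theorem onFst_smul_one (c : ℂ) :
    onFst (c • (1 : Matrix (Fin 2 × C) (Fin 2 × C) ℂ)) = c • 1 := by
  ext ⟨a, i, d⟩ ⟨b, j, e⟩
  simp only [onFst_apply, Matrix.smul_apply, Matrix.one_apply, Prod.mk.injEq]
  split_ifs <;> simp_all

theorem dress_mul_dress_neg (hU : ∀ x, ∃ c : ℂ, U x * U (-x) = c • 1) (x : ℂ) :
    ∃ c : ℂ, dress η ξ U x * dress η ξ U (-x) = c • 1 := by
  obtain ⟨c, hc⟩ := hU x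
  obtain ⟨c₁, h₁⟩ := rOn_mul_rOn_neg (C := C) η (x + ξ)
  obtain ⟨c₂, h₂⟩ := rOn_mul_rOn_neg (C := C) η (x - ξ)
  refine ⟨c₁ * c * c₂, ?_⟩
  have h := congrArg onFst hc
  rw [onFst_mul, onFst_smul_one] at h
  rw [dress, dress, show -x - ξ = -(x + ξ) by ring, show -x + ξ = -(x - ξ) by ring]
  calc _ = rOn C η (x - ξ) * onFst (U x) * (rOn C η (x + ξ) * rOn C η (-(x + ξ))) *
        onFst (U (-x)) * rOn C η (-(x - ξ)) := by simp only [Matrix.mul_assoc]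
    _ = c₁ • (rOn C η (x - ξ) * (onFst (U x) * onFst (U (-x))) * rOn C η (-(x - ξ))) := by
      rw [h₁]; simp only [Matrix.mul_smul, Matrix.smul_mul, Matrix.mul_one, Matrix.mul_assoc]
    _ = (c₁ * c * c₂) • 1 := by 
      rw [h]; simp only [Matrix.mul_smul, Matrix.smul_mul, Matrix.mul_one, h₂, smul_smul, mul_assoc]

end Steps

/-! ### Identification of configurations with a last site and a shorter configuration. -/

/-- Splitting off the last site of a configuration. -/
def lastEquiv (N : ℕ) : Config (N + 1) ≃ Fin 2 × Config N where
  toFun s := (s (Fin.last N), Fin.init s)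
  invFun t := Fin.snoc (α := fun _ => Fin 2) t.2 t.1
  left_inv s := Fin.snoc_init_self (α := fun _ => Fin 2) s
  right_inv t := by simp

section Relabel

set_option linter.unusedSectionVars false

variable {C D : Type*} [Fintype C] [DecidableEq C] [Fintype D] [DecidableEq D] (e : C ≃ D)

/-- Relabelling of the basis of the second factor. -/
def relabel (X : Matrix (Fin 2 × D) (Fin 2 × D) ℂ) : Matrix (Fin 2 × C) (Fin 2 × C) ℂ :=
  X.submatrix ((Equiv.refl _).prodCongr e) ((Equiv.refl _).prodCongr e)

theorem relabel_mul (X Y : Matrix (Fin 2 × D) (Fin 2 × D) ℂ) :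
    relabel e (X * Y) = relabel e X * relabel e Y := by
  rw [relabel, relabel, relabel, submatrix_mul_equiv]

theorem relabel_smul_one (c : ℂ) :
    relabel e (c • (1 : Matrix (Fin 2 × D) (Fin 2 × D) ℂ)) = c • 1 := by
  rw [relabel, submatrix_smul, Pi.smul_apply, Pi.smul_apply, submatrix_one_equiv]

theorem tens_comp (v : Fin 2 → ℂ) (ψ : D → ℂ) :
    tens v (ψ ∘ e) = tens v ψ ∘ ((Equiv.refl _).prodCongr e) := rfl

theorem vecMul_relabel (φ : Fin 2 × D → ℂ) (X : Matrix (Fin 2 × D) (Fin 2 × D) ℂ) :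
    (φ ∘ ((Equiv.refl _).prodCongr e)) ᵥ* relabel e X =
      (φ ᵥ* X) ∘ ((Equiv.refl _).prodCongr e) := by
  rw [relabel, submatrix_vecMul_equiv, Function.comp_assoc, Equiv.self_comp_symm, Function.comp_id]

theorem relabel_mulVec (φ : Fin 2 × D → ℂ) (X : Matrix (Fin 2 × D) (Fin 2 × D) ℂ) :
    relabel e X *ᵥ (φ ∘ ((Equiv.refl _).prodCongr e)) =
      (X *ᵥ φ) ∘ ((Equiv.refl _).prodCongr e) := by
  rw [relabel, submatrix_mulVec_equiv, Function.comp_assoc, Equiv.self_comp_symm, Function.comp_id]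

variable {U : ℂ → Matrix (Fin 2 × C) (Fin 2 × C) ℂ} {V : ℂ → Matrix (Fin 2 × D) (Fin 2 × D) ℂ}

theorem RowMap.relabel {e : C ≃ D} (hUV : ∀ x, U x = relabel e (V x)) {u x : ℂ} {ψ ψ' : D → ℂ}
    (h : RowMap V u x ψ ψ') : RowMap U u x (ψ ∘ e) (ψ' ∘ e) := by
  unfold RowMap at h ⊢
  rw [hUV, tens_comp, vecMul_relabel, h, tens_comp]

theorem ColMap.relabel {e : C ≃ D} (hUV : ∀ x, U x = relabel e (V x)) {u x : ℂ} {ψ ψ' : D → ℂ}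
    (h : ColMap V u x ψ ψ') : ColMap U u x (ψ ∘ e) (ψ' ∘ e) := by
  unfold ColMap at h ⊢
  rw [hUV, tens_comp, relabel_mulVec, h, tens_comp]

theorem OffDiagMap.relabel {e : C ≃ D} (hUV : ∀ x, U x = relabel e (V x)) {u x : ℂ}
    {ψ ψ' : D → ℂ} (h : OffDiagMap V u x ψ ψ') : OffDiagMap U u x (ψ ∘ e) (ψ' ∘ e) := by
  unfold OffDiagMap at h ⊢
  rw [hUV, tens_comp, vecMul_relabel, ← h]
  rfl

theorem ReflectionEq.relabel {e : C ≃ D} (hUV : ∀ x, U x = relabel e (V x)) {η : ℂ}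
    (h : ReflectionEq η V) : ReflectionEq η U := by
  intro x y
  let f : Fin 2 × Fin 2 × C ≃ Fin 2 × Fin 2 × D :=
    (Equiv.refl _).prodCongr ((Equiv.refl _).prodCongr e)
  have h1 : ∀ z, rOn C η z = (rOn D η z).submatrix f f := by
    intro z
    ext ⟨a, i, c⟩ ⟨b, j, d⟩
    simp [rOn_apply, f]
  have h2 : ∀ x, onFst (U x) = (onFst (V x)).submatrix f f := by
    intro z
    ext ⟨a, i, c⟩ ⟨b, j, d⟩
    simp [onFst_apply, f, hUV, OpenXXZ.relabel]
  have h3 : ∀ x, onSnd (U x) = (onSnd (V x)).submatrix f f := by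
    intro z
    ext ⟨a, i, c⟩ ⟨b, j, d⟩
    simp [onSnd_apply, f, hUV, OpenXXZ.relabel]
  simp only [h1, h2, h3, submatrix_mul_equiv]
  rw [h x y]

theorem comp_dotProduct_comp (ψ φ : D → ℂ) : (ψ ∘ e) ⬝ᵥ (φ ∘ e) = ψ ⬝ᵥ φ :=
  comp_equiv_dotProduct_comp_equiv ψ φ e

end Relabel

/-! ### Operators of the shorter chain and crossing symmetry of R. -/

section Sites

variable {N : ℕ}

/-- An operator of the chain without the last site as an operator of the whole chain. -/
noncomputable def liftOp (N : ℕ) : Op N →+* Op (N + 1) where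
  toFun X := ((1 : Matrix (Fin 2) (Fin 2) ℂ) ⊗ₖ X).submatrix (lastEquiv N) (lastEquiv N)
  map_one' := by rw [one_kronecker_one, submatrix_one_equiv]
  map_mul' X Y := by rw [submatrix_mul_equiv, ← mul_kronecker_mul, one_mul]
  map_zero' := by rw [kronecker_zero]; rfl
  map_add' X Y := by rw [kronecker_add]; rfl

theorem liftOp_apply (X : Op N) (s t : Config (N + 1)) :
    liftOp N X s t = if s (Fin.last N) = t (Fin.last N) then X (Fin.init s) (Fin.init t) else 0 := by
  simp [liftOp, Matrix.one_apply, lastEquiv]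

theorem liftOp_smul (c : ℂ) (X : Op N) : liftOp N (c • X) = c • liftOp N X := by
  ext s t
  simp only [liftOp_apply, Matrix.smul_apply]
  split_ifs <;> simp

theorem siteOp_castSucc (n : Fin N) (m : Matrix (Fin 2) (Fin 2) ℂ) :
    siteOp n.castSucc m = liftOp N (siteOp n m) := by
  ext s t
  simp only [siteOp, of_apply, liftOp_apply, Fin.init]
  have : (∀ k, k ≠ n.castSucc → s k = t k) ↔
      (s (Fin.last N) = t (Fin.last N) ∧ ∀ k : Fin N, k ≠ n → s k.castSucc = t k.castSucc) := by
    constructor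
    · exact fun h => ⟨h _ (Fin.castSucc_lt_last n).ne', fun k hk => h _ (by simpa using hk)⟩
    · rintro ⟨h1, h2⟩ k
      refine Fin.lastCases (fun _ => h1) (fun k hk => h2 k (by simpa using hk)) k
  simp only [this, ite_and]
  congr

theorem siteOp_last (m : Matrix (Fin 2) (Fin 2) ℂ) :
    siteOp (Fin.last N) m =
      (m ⊗ₖ (1 : Op N)).submatrix (lastEquiv N) (lastEquiv N) := by
  ext s t
  have : (∀ k, k ≠ Fin.last N → s k = t k) ↔ Fin.init s = Fin.init t := by
    constructor
    · exact fun h => funext fun k => h _ (Fin.castSucc_lt_last k).ne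
    · intro h k
      refine Fin.lastCases (fun h => absurd rfl h) (fun k _ => congrFun h k) k
  simp [siteOp, this, Matrix.one_apply, lastEquiv]

theorem siteOp_last_comm (m : Matrix (Fin 2) (Fin 2) ℂ) (X : Op N) :
    siteOp (Fin.last N) m * liftOp N X = liftOp N X * siteOp (Fin.last N) m := by
  rw [siteOp_last]
  change _ * Matrix.submatrix _ _ _ = Matrix.submatrix _ _ _ * _
  rw [submatrix_mul_equiv, submatrix_mul_equiv, ← mul_kronecker_mul, ← mul_kronecker_mul]
  simp

theorem rAux_castSucc (η : ℂ) (n : Fin N) (z : ℂ) :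
    rAux η n.castSucc z = (liftOp N).mapMatrix (rAux η n z) := by
  refine Matrix.ext fun i j => ?_
  exact siteOp_castSucc _ _

theorem auxScalar_mul (m m' : Matrix (Fin 2) (Fin 2) ℂ) :
    auxScalar N (m * m') = auxScalar N m * auxScalar N m' := by
  refine Matrix.ext fun i j => ?_
  simp [auxScalar, Matrix.mul_apply, Fin.sum_univ_two, add_smul, smul_smul, mul_comm]

theorem auxScalar_one : auxScalar N 1 = 1 := by
  refine Matrix.ext fun i j => ?_
  fin_cases i <;> fin_cases j <;> simp [auxScalar]

theorem sigmaY_mul_sigmaY : sigmaY * sigmaY = 1 := by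
  ext i j
  fin_cases i <;> fin_cases j <;> simp [sigmaY]

theorem mapMatrix_auxScalar (m : Matrix (Fin 2) (Fin 2) ℂ) :
    (liftOp N).mapMatrix (auxScalar N m) = auxScalar (N + 1) m := by
  refine Matrix.ext fun i j => ?_
  simp [auxScalar, liftOp_smul]

/-- Crossing symmetry. It turns the transposed monodromy in `bulkHat` into an ordinary product of
R-matrices in the opposite order; its sign at each site is what the prefactor (-1)^N absorbs. -/
theorem sigmaY_mul_rAux_mul_sigmaY (η : ℂ) (n : Fin N) (z : ℂ) :
    auxScalar N sigmaY * (rAux η n z)ᵀ * auxScalar N sigmaY = -rAux η n (-z - η) := by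
  have h0 : sinh (-z - η) = -sinh (z + η) := by rw [← sinh_neg]; ring_nf
  have hin : ∀ m {s t : Config N}, (∀ k, k ≠ n → s k = t k) → siteOp n m s t = m (s n) (t n) :=
    fun m s t h => if_pos h
  have hout : ∀ m {s t : Config N}, ¬(∀ k, k ≠ n → s k = t k) → siteOp n m s t = 0 :=
    fun m s t h => if_neg h
  ext i j s t
  by_cases hst : ∀ k, k ≠ n → s k = t k
  · generalize ha : s n = a
    generalize hb : t n = b
    fin_cases i <;> fin_cases j <;> fin_cases a <;> fin_cases b <;>
      simp [auxScalar, sigmaY, Matrix.mul_apply, Fin.sum_univ_two, rAux, hin _ hst, ha, hb,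
        rMatrix_apply, h0, ← mul_assoc]
  · fin_cases i <;> fin_cases j <;>
      simp [auxScalar, sigmaY, Matrix.mul_apply, Fin.sum_univ_two, rAux, hout _ hst]

end Sites

/-! ### Recursion of the boundary monodromy matrix in the number of sites. -/

namespace Params

variable {N : ℕ}

/-- The chain without its last site. -/
noncomputable def init (p : Params (N + 1)) : Params N :=
  ⟨p.η, fun n => p.ξ n.castSucc, p.ζm, p.κm, p.τm, p.αm, p.βm, p.α⟩

theorem bulk_succ (p : Params (N + 1)) (lam : ℂ) :
    p.bulk lam = rAux p.η (Fin.last N) (lam - p.ξ (Fin.last N) - p.η / 2) *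
      (liftOp N).mapMatrix (p.init.bulk lam) := by
  rw [bulk, bulk, List.ofFn_succ', List.concat_eq_append, List.reverse_append, List.reverse_singleton,
    List.singleton_append, List.prod_cons, map_list_prod, List.map_reverse, List.map_ofFn]
  simp only [rAux_castSucc]
  rfl

theorem bulkHat_succ (p : Params (N + 1)) (lam : ℂ) :
    p.bulkHat lam = (liftOp N).mapMatrix (p.init.bulkHat lam) *
      rAux p.η (Fin.last N) (lam + p.ξ (Fin.last N) - p.η / 2) := by
  -- Transposition in the auxiliary space alone reverses this product because the operator entries
  -- of the two factors act on different sites and commute.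
  have hT : ∀ (z : ℂ) (X : AuxOp N),
      (rAux p.η (Fin.last N) z * (liftOp N).mapMatrix X)ᵀ =
        (liftOp N).mapMatrix Xᵀ * (rAux p.η (Fin.last N) z)ᵀ := by
    intro z X
    refine Matrix.ext fun i j => ?_
    simp only [transpose_apply, Matrix.mul_apply]
    exact Finset.sum_congr rfl fun k _ => siteOp_last_comm _ _
  have hσ : auxScalar (N + 1) sigmaY * auxScalar (N + 1) sigmaY = 1 := by
    rw [← auxScalar_mul, sigmaY_mul_sigmaY, auxScalar_one]
  have hlift : (liftOp N).mapMatrix (p.init.bulkHat lam) =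
      (-1 : ℂ) ^ N • (auxScalar (N + 1) sigmaY *
        (liftOp N).mapMatrix (p.init.bulk (-lam))ᵀ * auxScalar (N + 1) sigmaY) := by
    rw [bulkHat, ← mapMatrix_auxScalar, ← map_mul, ← map_mul]
    exact Matrix.ext fun i j => liftOp_smul _ _
  have h1 := sigmaY_mul_rAux_mul_sigmaY p.η (Fin.last N)
    (-lam - p.ξ (Fin.last N) - p.η / 2)
  rw [show -(-lam - p.ξ (Fin.last N) - p.η / 2) - p.η = lam + p.ξ (Fin.last N) - p.η / 2 by
    ring] at h1
  rw [hlift, bulkHat, bulk_succ, hT, ← neg_neg (rAux _ _ (lam + _ - _)), ← h1]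
  generalize auxScalar (N + 1) sigmaY = σ at *
  generalize (liftOp N).mapMatrix (p.init.bulk (-lam))ᵀ = X
  generalize (rAux p.η (Fin.last N) (-lam - p.ξ (Fin.last N) - p.η / 2))ᵀ = Y
  have h2 : σ * X * σ * (σ * Y * σ) = σ * (X * Y) * σ := by
    calc _ = σ * X * (σ * σ) * Y * σ := by simp only [Matrix.mul_assoc]
      _ = _ := by rw [hσ]; simp only [Matrix.mul_one, Matrix.mul_assoc]
  rw [smul_mul_assoc, Matrix.mul_neg, h2, pow_succ]
  simp

theorem boundaryU_succ (p : Params (N + 1)) (lam : ℂ) :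
    p.boundaryU lam = rAux p.η (Fin.last N) (lam - p.ξ (Fin.last N) - p.η / 2) *
      (liftOp N).mapMatrix (p.init.boundaryU lam) *
        rAux p.η (Fin.last N) (lam + p.ξ (Fin.last N) - p.η / 2) := by
  rw [boundaryU, boundaryU, bulk_succ, bulkHat_succ, map_mul, map_mul, mapMatrix_auxScalar]
  simp only [Matrix.mul_assoc]
  rfl

/-- An operator on `H₀ ⊗ H` as a matrix of numbers. -/
def _root_.OpenXXZ.flat (X : AuxOp N) : Matrix (Fin 2 × Config N) (Fin 2 × Config N) ℂ :=
  Matrix.of fun s t => X s.1 t.1 s.2 t.2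

theorem _root_.OpenXXZ.flat_mul (X Y : AuxOp N) : flat (X * Y) = flat X * flat Y := by
  ext ⟨i, s⟩ ⟨j, t⟩
  simp [flat, Matrix.mul_apply, Matrix.sum_apply, Fintype.sum_prod_type]

theorem _root_.OpenXXZ.flat_rAux_last (η z : ℂ) :
    flat (rAux η (Fin.last N) z) = relabel (lastEquiv N) (rOn (Config N) η z) := by
  ext ⟨i, s⟩ ⟨j, t⟩
  simp [flat, rAux, siteOp_last, relabel, rOn_apply, Matrix.one_apply, lastEquiv]

theorem _root_.OpenXXZ.flat_mapMatrix_liftOp (X : AuxOp N) :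
    flat ((liftOp N).mapMatrix X) = relabel (lastEquiv N) (onFst (flat X)) := by
  ext ⟨i, s⟩ ⟨j, t⟩
  simp only [flat, RingHom.mapMatrix_apply, map_apply, liftOp_apply, relabel, submatrix_apply,
    Equiv.prodCongr_apply, Prod.map, onFst_apply, lastEquiv, of_apply, Equiv.coe_fn_mk]
  rfl

/-- The boundary monodromy matrix, in the variable centred at `η/2`, as a matrix on
`ℂ² ⊗ H`. -/
noncomputable def opU (p : Params N) (x : ℂ) : Matrix (Fin 2 × Config N) (Fin 2 × Config N) ℂ :=
  flat (p.boundaryU (x + p.η / 2))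

theorem opU_succ (p : Params (N + 1)) (x : ℂ) :
    p.opU x = relabel (lastEquiv N) (dress p.η (p.ξ (Fin.last N)) p.init.opU x) := by
  rw [opU, boundaryU_succ, flat_mul, flat_mul, flat_rAux_last, flat_rAux_last,
    flat_mapMatrix_liftOp, dress, relabel_mul, relabel_mul,
    show x + p.η / 2 - p.ξ (Fin.last N) - p.η / 2 = x - p.ξ (Fin.last N) by ring,
    show x + p.η / 2 + p.ξ (Fin.last N) - p.η / 2 = x + p.ξ (Fin.last N) by ring]
  rfl

theorem opU_zero (p : Params 0) (x : ℂ) (a b : Fin 2) (s t : Config 0) :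
    p.opU x (a, s) (b, t) = p.boundaryK (x + p.η / 2) a b := by
  have h1 : ∀ lam, p.bulk lam = 1 := fun lam => by simp [bulk]
  have h2 : ∀ lam, p.bulkHat lam = 1 := fun lam => by
    rw [bulkHat, h1, transpose_one, Matrix.mul_one, ← auxScalar_mul, sigmaY_mul_sigmaY,
      auxScalar_one, pow_zero, one_smul]
  obtain rfl : s = t := Subsingleton.elim _ _
  simp [opU, flat, boundaryU, h1, h2, auxScalar]

theorem boundaryK_eq (p : Params N) (x : ℂ) :
    p.boundaryK (x + p.η / 2) = (1 / sinh p.ζm) •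
      !![sinh (x + p.ζm), p.κm * exp p.τm * sinh (2 * x);
        p.κm * exp (-p.τm) * sinh (2 * x), sinh (p.ζm - x)] := by
  rw [boundaryK, show x + p.η / 2 - p.η / 2 + p.ζm = x + p.ζm by ring,
    show 2 * (x + p.η / 2) - p.η = 2 * x by ring,
    show p.ζm - (x + p.η / 2) + p.η / 2 = p.ζm - x by ring]

set_option maxHeartbeats 1000000 in
theorem reflectionEq_zero (p : Params 0) : ReflectionEq p.η p.opU := by
  intro x y
  ext ⟨a, i, s⟩ ⟨b, j, t⟩
  have hr : ∀ z a i b j (c d : Config 0),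
      rOn (Config 0) p.η z (a, i, c) (b, j, d) = rMatrix p.η z (a, i) (b, j) :=
    fun z a i b j c d => by rw [rOn_apply, if_pos (Subsingleton.elim _ _)]
  simp only [Matrix.mul_apply, Fintype.sum_prod_type, onFst_apply, onSnd_apply, hr,
    opU_zero, Fin.sum_univ_two, Finset.univ_unique, Finset.sum_singleton, boundaryK_eq, Matrix.smul_apply,
    smul_eq_mul]
  generalize 1 / sinh p.ζm = f
  generalize p.κm * exp p.τm = k₁
  generalize p.κm * exp (-p.τm) = k₂
  fin_cases a <;> fin_cases i <;> fin_cases b <;> fin_cases j <;>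
    simp [rMatrix_apply, sinh, two_mul, sub_eq_add_neg, exp_add, exp_neg] <;>
    field_simp <;> ring

theorem reflectionEq_opU : ∀ {N : ℕ} (p : Params N), ReflectionEq p.η p.opU
  | 0, p => p.reflectionEq_zero
  | _ + 1, p => (ReflectionEq.dress (reflectionEq_opU p.init) _).relabel p.opU_succ

/-- Unitarity up to a scalar: it holds for K_- by direct computation, and dressing preserves it
because R(z)R(-z) is scalar. -/
theorem opU_mul_opU_neg : ∀ {N : ℕ} (p : Params N) (x : ℂ),
    ∃ c : ℂ, p.opU x * p.opU (-x) = c • 1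
  | 0, p, x => by
    refine ⟨(1 / sinh p.ζm) ^ 2 * (sinh (x + p.ζm) * sinh (p.ζm - x) - p.κm ^ 2 * sinh (2 * x) ^ 2),
      ?_⟩
    have hτ : exp p.τm * exp (-p.τm) = 1 := by rw [← exp_add, add_neg_cancel, exp_zero]
    ext ⟨a, s⟩ ⟨b, t⟩
    obtain rfl : s = default := Subsingleton.elim _ _
    obtain rfl : t = default := Subsingleton.elim _ _
    simp only [Matrix.mul_apply, Fintype.sum_prod_type, opU_zero, Fin.sum_univ_two,
      Finset.univ_unique, Finset.sum_singleton, boundaryK_eq, Matrix.smul_apply, smul_eq_mul,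
      mul_neg, sinh_neg, sub_neg_eq_add, Matrix.one_apply]
    rw [show -x + p.ζm = p.ζm - x by ring, show p.ζm + x = x + p.ζm by ring]
    fin_cases a <;> fin_cases b <;> simp
    · linear_combination (-(sinh p.ζm)⁻¹ ^ 2 * p.κm ^ 2 * sinh (2 * x) ^ 2) * hτ
    · ring
    · ring
    · linear_combination (-(sinh p.ζm)⁻¹ ^ 2 * p.κm ^ 2 * sinh (2 * x) ^ 2) * hτ
  | _ + 1, p, x => by
    obtain ⟨c, hc⟩ := dress_mul_dress_neg (η := p.η) (p.ξ (Fin.last _)) (opU_mul_opU_neg p.init) x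
    exact ⟨c, by rw [opU_succ, opU_succ, ← relabel_mul, hc, relabel_smul_one]⟩

end Params

theorem leftExt_smul {C : Type*} [Fintype C] [DecidableEq C] (u ξ c : ℂ) (ψ : C → ℂ) :
    leftExt u ξ (c • ψ) = c • leftExt u ξ ψ := tens_smul _ _ _

theorem leftRefl_smul {C : Type*} [Fintype C] [DecidableEq C] (U : ℂ → Matrix (Fin 2 × C) (Fin 2 × C) ℂ)
    (u ξ c : ℂ) (ψ : C → ℂ) : leftRefl U u ξ (c • ψ) = c • leftRefl U u ξ ψ := by
  rw [leftRefl, tens_smul, smul_vecMul, leftRefl]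

theorem rightExt_smul {C : Type*} [Fintype C] [DecidableEq C] (u ξ c : ℂ) (ψ : C → ℂ) :
    rightExt u ξ (c • ψ) = c • rightExt u ξ ψ := tens_smul _ _ _

theorem rightRefl_smul {C : Type*} [Fintype C] [DecidableEq C] (U : ℂ → Matrix (Fin 2 × C) (Fin 2 × C) ℂ)
    (u ξ c : ℂ) (ψ : C → ℂ) : rightRefl U u ξ (c • ψ) = c • rightRefl U u ξ ψ := by
  rw [rightRefl, tens_smul, mulVec_smul, rightRefl]

/-! ### States built site by site, and the action of the diagonal entries on them. -/

namespace Params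

/-- The left states, built site by site: a site with label `0` is in its reference state, a site
with label `1` is reflected by the boundary operator of the chain of the previous sites. -/
noncomputable def leftState : ∀ {N : ℕ}, Params N → ℂ → Config N → Config N → ℂ
  | 0, _, _, _ => fun _ => 1
  | N + 1, p, u, h =>
    (if h (Fin.last N) = 0 then
      leftExt (u * exp p.η) (p.ξ (Fin.last N)) (leftState p.init (u * exp p.η) (Fin.init h))
    else
      leftRefl p.init.opU (u * exp p.η) (p.ξ (Fin.last N))
        (leftState p.init (u * exp p.η) (Fin.init h))) ∘ lastEquiv N

/-- The right states, built site by site. -/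
noncomputable def rightState : ∀ {N : ℕ}, Params N → ℂ → Config N → Config N → ℂ
  | 0, _, _, _ => fun _ => 1
  | N + 1, p, v, k =>
    (if k (Fin.last N) = 1 then
      rightExt (v * exp (-p.η)) (p.ξ (Fin.last N))
        (rightState p.init (v * exp (-p.η)) (Fin.init k))
    else
      rightRefl p.init.opU (v * exp (-p.η)) (p.ξ (Fin.last N))
        (rightState p.init (v * exp (-p.η)) (Fin.init k))) ∘ lastEquiv N

/-- The factor produced when the label `n` of a left state is raised. -/
noncomputable def leftConst {N : ℕ} (p : Params N) (n : Fin N) : ℂ :=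
  sinh p.η * sinh (p.η - 2 * p.ξ n) *
    ∏ m, if n < m then sinh (-p.ξ n - p.ξ m + p.η) * sinh (-p.ξ n + p.ξ m + p.η) else 1

/-- The factor produced when the label `n` of a right state is lowered. -/
noncomputable def rightConst {N : ℕ} (p : Params N) (n : Fin N) : ℂ :=
  sinh p.η * sinh (2 * p.ξ n + p.η) *
    ∏ m, if n < m then sinh (p.ξ n - p.ξ m + p.η) * sinh (p.ξ n + p.ξ m + p.η) else 1

variable {N : ℕ}

theorem leftConst_castSucc (p : Params (N + 1)) (n : Fin N) :
    p.leftConst n.castSucc = p.init.leftConst n *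
      (sinh (-p.ξ n.castSucc - p.ξ (Fin.last N) + p.η) *
        sinh (-p.ξ n.castSucc + p.ξ (Fin.last N) + p.η)) := by
  rw [leftConst, leftConst, Fin.prod_univ_castSucc, if_pos (Fin.castSucc_lt_last n)]
  simp only [Fin.castSucc_lt_castSucc_iff, init, mul_assoc]

theorem leftConst_last (p : Params (N + 1)) :
    p.leftConst (Fin.last N) = sinh p.η * sinh (p.η - 2 * p.ξ (Fin.last N)) := by
  rw [leftConst, Finset.prod_eq_one fun m _ => if_neg (Fin.le_last m).not_gt, mul_one]

theorem rightConst_castSucc (p : Params (N + 1)) (n : Fin N) :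
    p.rightConst n.castSucc = p.init.rightConst n *
      (sinh (p.ξ n.castSucc - p.ξ (Fin.last N) + p.η) *
        sinh (p.ξ n.castSucc + p.ξ (Fin.last N) + p.η)) := by
  rw [rightConst, rightConst, Fin.prod_univ_castSucc, if_pos (Fin.castSucc_lt_last n)]
  simp only [Fin.castSucc_lt_castSucc_iff, init, mul_assoc]

theorem rightConst_last (p : Params (N + 1)) :
    p.rightConst (Fin.last N) = sinh p.η * sinh (2 * p.ξ (Fin.last N) + p.η) := by
  rw [rightConst, Finset.prod_eq_one fun m _ => if_neg (Fin.le_last m).not_gt, mul_one]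

/-- Site `n` is flipped when it is the outermost one; every later site only multiplies by a scalar
that is the same for both of its labels, so the constant does not depend on `h`. -/
theorem rowMap_leftState : ∀ {N : ℕ} (p : Params N) (u : ℂ) (h : Config N) (n : Fin N),
    h n = 0 → RowMap p.opU u (-p.ξ n) (p.leftState u h)
      (p.leftConst n • p.leftState u (Function.update h n 1))
  | N + 1, p, u, h, n => by
    refine Fin.lastCases (fun hn => ?_) (fun n hn => ?_) n
    · have key := rowMap_leftExt_new (η := p.η) (U := p.init.opU) (p.ξ (Fin.last N)) u
        (p.init.leftState (u * exp p.η) (Fin.init h))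
      rw [leftConst_last, leftState, leftState, if_pos hn, Fin.init_update_last,
        Function.update_self, if_neg one_ne_zero]
      exact key.relabel p.opU_succ
    · have ih := rowMap_leftState p.init (u * exp p.η) (Fin.init h) n hn
      have hne : Fin.last N ≠ n.castSucc := (Fin.castSucc_lt_last n).ne'
      rw [leftState, leftState, Fin.init_update_castSucc, Function.update_of_ne hne,
        leftConst_castSucc]
      split_ifs
      · have key := (RowMap.leftExt (p.ξ (Fin.last N)) ih).relabel p.opU_succ
        rw [leftExt_smul, smul_smul, mul_comm _ (p.init.leftConst n)] at key
        exact key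
      · have key := (RowMap.leftRefl (p.ξ (Fin.last N)) p.init.reflectionEq_opU ih).relabel
          p.opU_succ
        rw [leftRefl_smul, smul_smul, mul_comm _ (p.init.leftConst n)] at key
        exact key

theorem colMap_rightState : ∀ {N : ℕ} (p : Params N) (v : ℂ) (k : Config N) (n : Fin N),
    k n = 1 → ColMap p.opU v (p.ξ n) (p.rightState v k)
      (p.rightConst n • p.rightState v (Function.update k n 0))
  | N + 1, p, v, k, n => by
    have hv : v * exp (-p.η) * exp p.η = v := by
      rw [mul_assoc, ← exp_add, neg_add_cancel, exp_zero, mul_one]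
    refine Fin.lastCases (fun hn => ?_) (fun n hn => ?_) n
    · have key := colMap_rightExt_new (η := p.η) (U := p.init.opU) (p.ξ (Fin.last N))
        (v * exp (-p.η)) (p.init.rightState (v * exp (-p.η)) (Fin.init k))
      rw [hv] at key
      rw [rightConst_last, rightState, rightState, if_pos hn, Fin.init_update_last,
        Function.update_self, if_neg zero_ne_one]
      exact key.relabel p.opU_succ
    · have ih := colMap_rightState p.init (v * exp (-p.η)) (Fin.init k) n hn
      have hne : Fin.last N ≠ n.castSucc := (Fin.castSucc_lt_last n).ne'
      rw [rightState, rightState, Fin.init_update_castSucc, Function.update_of_ne hne,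
        rightConst_castSucc]
      split_ifs
      · have key := (ColMap.rightExt (η := p.η) (p.ξ (Fin.last N)) ih).relabel p.opU_succ
        rw [rightExt_smul, smul_smul, mul_comm _ (p.init.rightConst n), hv] at key
        exact key
      · have key := (ColMap.rightRefl (p.ξ (Fin.last N)) p.init.reflectionEq_opU ih).relabel
          p.opU_succ
        change ColMap _ (v * exp (-p.η) * exp p.η) _ _ _ at key
        rw [rightRefl_smul, smul_smul, mul_comm _ (p.init.rightConst n), hv] at key
        exact key

/-! ### Pseudo-eigenvalues and the recursion for the pairing. -/

/-- The off-diagonal entry of `K_-` in the gauge `v`, up to a factor depending on `λ`. -/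
noncomputable def gaugedK (p : Params N) (v : ℂ) : ℂ :=
  v * exp p.ζm + p.κm * (exp p.τm - v ^ 2 * exp (-p.τm))

/-- The factor of the site `m` with label `h` in the pseudo-eigenvalue. -/
noncomputable def eigFactor (p : Params N) (h : Fin 2) (m : Fin N) (x : ℂ) : ℂ :=
  if h = 0 then sinh (x - p.ξ m + p.η) * sinh (x + p.ξ m)
  else sinh (x + p.ξ m + p.η) * sinh (x - p.ξ m)

/-- The pseudo-eigenvalue of the off-diagonal entry of the gauged boundary operator. -/
noncomputable def pseudoEig (p : Params N) (u : ℂ) (h : Config N) (x : ℂ) : ℂ :=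
  sinh (2 * x) / sinh p.ζm * p.gaugedK (u * exp (N * p.η)) * ∏ m, p.eigFactor (h m) m x

/-- Each site multiplies the gauge seen by the inner chain by e^η, so K_- itself is reached in the
gauge u e^{Nη}. On the way back each site contributes its `eigFactor`. -/
theorem offDiagMap_leftState : ∀ {N : ℕ} (p : Params N) (u : ℂ) (h : Config N) (x : ℂ),
    OffDiagMap p.opU u x (p.leftState u h)
      (p.pseudoEig u h x • p.leftState (u * exp (-(2 * p.η))) h)
  | 0, p, u, h, x => by
    unfold OffDiagMap
    ext s
    simp only [contr, vecMul, dotProduct, Fintype.sum_prod_type, opU_zero, boundaryK_eq, leftState,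
      pseudoEig, gaugedK, tens, Fin.sum_univ_two, Finset.univ_unique, Finset.sum_singleton,
      Pi.smul_apply, rowVec, colVec]
    simp [sinh, two_mul, sub_eq_add_neg, exp_add, exp_neg]
    field_simp
    ring_nf
  | N + 1, p, u, h, x => by
    have ih := offDiagMap_leftState p.init (u * exp p.η) (Fin.init h) x
    have hu : u * exp (-(2 * p.η)) * exp p.η = u * exp (-p.η) := by
      rw [mul_assoc, ← exp_add]; ring_nf
    have hu' : u * exp p.η * exp (-(2 * p.init.η)) = u * exp (-p.η) := by
      rw [mul_assoc, init, ← exp_add]; ring_nf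
    have hK : p.init.gaugedK (u * exp p.η * exp (N * p.init.η)) =
        p.gaugedK (u * exp ((N + 1 : ℕ) * p.η)) := by
      rw [mul_assoc, init, ← exp_add]
      simp only [gaugedK]
      push_cast
      ring_nf
    have hE : ∀ c, p.eigFactor (h (Fin.last N)) (Fin.last N) x = c →
        c * p.init.pseudoEig (u * exp p.η) (Fin.init h) x = p.pseudoEig u h x := by
      rintro _ rfl
      rw [pseudoEig, pseudoEig, hK, Fin.prod_univ_castSucc]
      simp only [eigFactor, init, Fin.init]
      ring_nf
    rw [leftState, leftState, hu]
    rw [hu'] at ih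
    by_cases hl : h (Fin.last N) = 0
    · have key := (OffDiagMap.leftExt (p.ξ (Fin.last N)) ih).relabel p.opU_succ
      rw [leftExt_smul, smul_smul, hE _ (by rw [hl, eigFactor, if_pos rfl])] at key
      rw [if_pos hl, if_pos hl]
      exact key
    · have key := (OffDiagMap.leftRefl (p.ξ (Fin.last N)) p.init.reflectionEq_opU ih).relabel
        p.opU_succ
      rw [leftRefl_smul, smul_smul, hE _ (by rw [eigFactor, if_neg hl]; rfl)] at key
      rw [if_neg hl, if_neg hl]
      exact key

/-- The offset e^{2η} makes both last-site gauges equal to u e^η. The pseudo-eigenvalue then moves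
the inner left gauge to u e^{-η} while the inner right one stays at u e^η, so the same offset
recurs. -/
theorem leftState_dotProduct_rightState_succ (p : Params (N + 1)) (u : ℂ) (h k : Config (N + 1)) :
    p.leftState u h ⬝ᵥ p.rightState (u * exp (2 * p.η)) k =
      if h (Fin.last N) = k (Fin.last N) then
        p.init.pseudoEig (u * exp p.η) (Fin.init h)
          (if h (Fin.last N) = 0 then p.ξ (Fin.last N) else -p.ξ (Fin.last N)) *
        (p.init.leftState (u * exp (-p.η)) (Fin.init h) ⬝ᵥ
          p.init.rightState (u * exp (-p.η) * exp (2 * p.η)) (Fin.init k))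
      else 0 := by
  have hu : u * exp (2 * p.η) * exp (-p.η) = u * exp p.η := by
    rw [mul_assoc, ← exp_add]; ring_nf
  have hu1 : u * exp (-p.η) * exp (2 * p.η) = u * exp p.η := by
    rw [mul_assoc, ← exp_add]; ring_nf
  have hu2 : u * exp p.η * exp (-(2 * p.init.η)) = u * exp (-p.η) := by
    rw [mul_assoc, init, ← exp_add]; ring_nf
  have heig := fun x => p.init.offDiagMap_leftState (u * exp p.η) (Fin.init h) x
  rw [hu2] at heig
  rw [leftState, rightState, comp_dotProduct_comp, hu, hu1]
  generalize h (Fin.last N) = a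
  generalize k (Fin.last N) = b
  fin_cases a <;> fin_cases b
  · simp only [Fin.zero_eta, if_true, if_false, zero_ne_one]
    rw [leftExt_dotProduct_rightRefl _ (heig _), smul_dotProduct, smul_eq_mul]
  · simp only [Fin.zero_eta, Fin.mk_one, if_true, if_false, zero_ne_one]
    rw [leftExt_dotProduct_rightExt]
  · simp only [Fin.zero_eta, Fin.mk_one, if_false, one_ne_zero, zero_ne_one]
    obtain ⟨c, hc⟩ := p.init.opU_mul_opU_neg (-p.ξ (Fin.last N))
    rw [neg_neg] at hc
    rw [leftRefl_dotProduct_rightRefl _ hc]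
  · simp only [Fin.mk_one, if_true, if_false, one_ne_zero]
    rw [leftRefl_dotProduct_rightExt _ (heig _), smul_dotProduct, smul_eq_mul]

end Params

/-! ### Ordered products of flipping operators. -/

section ListActions

variable {N : ℕ} (S : Config N → Config N → ℂ) (M : Fin N → Op N) (c : Fin N → ℂ)

/-- The starting configuration is generalized for the induction, since the head of the list acts
first. Absence of repetitions ensures that each site still has label 0 when its turn comes. -/
theorem vecMul_list_prod (hS : ∀ g n, g n = 0 → S g ᵥ* M n = c n • S (Function.update g n 1))
    (h : Config N) : ∀ (l : List (Fin N)) (g : Config N), l.Nodup → (∀ n ∈ l, g n = 0) →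
      S g ᵥ* (l.map fun n => M n ^ (h n : ℕ)).prod =
        (l.map fun n => if h n = 0 then 1 else c n).prod •
          S (fun n => if n ∈ l then h n else g n)
  | [], g, _, _ => by simp
  | a :: l, g, hl, hg => by
    obtain ⟨ha, hl⟩ := List.nodup_cons.mp hl
    have hga := hg a List.mem_cons_self
    rw [List.map_cons, List.prod_cons, List.map_cons, List.prod_cons, ← vecMul_vecMul]
    by_cases h0 : h a = 0
    · rw [h0, Fin.val_zero, pow_zero, vecMul_one, if_pos rfl, one_mul,
        vecMul_list_prod hS h l g hl fun n hn => hg n (List.mem_cons_of_mem _ hn)]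
      congr 2
      ext n
      by_cases hn : n = a
      · subst hn; simp [ha, h0, hga]
      · simp [hn]
    · have h1 : h a = 1 := by omega
      rw [h1, if_neg one_ne_zero, show ((1 : Fin 2) : ℕ) = 1 from rfl, pow_one, hS g a hga,
        smul_vecMul, vecMul_list_prod hS h l (Function.update g a 1) hl, smul_smul]
      · congr 2
        ext n
        by_cases hn : n = a
        · subst hn; simp [ha, h1]
        · simp [hn]
      · intro n hn
        rw [Function.update_of_ne (by rintro rfl; exact ha hn)]
        exact hg n (List.mem_cons_of_mem _ hn)

theorem list_prod_mulVec (hS : ∀ g n, g n = 1 → M n *ᵥ S g = c n • S (Function.update g n 0))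
    (h : Config N) : ∀ (l : List (Fin N)) (g : Config N), l.Nodup → (∀ n ∈ l, g n = 1) →
      (l.map fun n => M n ^ (1 - (h n : ℕ))).prod *ᵥ S g =
        (l.map fun n => if h n = 0 then c n else 1).prod •
          S (fun n => if n ∈ l then h n else g n)
  | [], g, _, _ => by simp
  | a :: l, g, hl, hg => by
    obtain ⟨ha, hl⟩ := List.nodup_cons.mp hl
    have hga := hg a List.mem_cons_self
    rw [List.map_cons, List.prod_cons, List.map_cons, List.prod_cons, ← mulVec_mulVec,
      list_prod_mulVec hS h l g hl fun n hn => hg n (List.mem_cons_of_mem _ hn), mulVec_smul]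
    by_cases h0 : h a = 0
    · rw [h0, if_pos rfl, Fin.val_zero, Nat.sub_zero, pow_one, hS _ a (by simp [ha, hga]),
        smul_smul, mul_comm]
      congr 2
      ext n
      by_cases hn : n = a
      · subst hn; simp [h0]
      · simp [hn]
    · have h1 : h a = 1 := by omega
      rw [h1, if_neg one_ne_zero, show 1 - ((1 : Fin 2) : ℕ) = 0 from rfl, pow_zero, one_mulVec,
        one_mul]
      congr 2
      ext n
      by_cases hn : n = a
      · subst hn; simp [ha, h1, hga]
      · simp [hn]

end ListActions

/-! ### Identification of the SOV states with the recursive states. -/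

namespace Params

variable {N : ℕ} (p : Params N)

/-- The parameter of the second column of the gauge matrix `G̃(λ|β)`. -/
noncomputable def gaugeParam (β : ℂ) : ℂ := exp (-((p.α - β + 1) * p.η))

theorem gaugedU_apply (x β : ℂ) (i j : Fin 2) :
    p.gaugedU (x + p.η / 2) β i j = exp (-x) • ∑ a, ∑ b,
      ((p.gaugeG x β)⁻¹ i a * p.gaugeG (-x) β b j) • p.boundaryU (x + p.η / 2) a b := by
  rw [gaugedU, show -(x + p.η / 2) + p.η / 2 = -x by ring, show x + p.η / 2 - p.η / 2 = x by ring,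
    show p.η / 2 - (x + p.η / 2) = -x by ring]
  simp only [Matrix.smul_apply, Matrix.mul_apply, auxScalar, Matrix.map_apply, Fin.sum_univ_two,
    smul_mul_assoc, one_mul, mul_smul_comm, mul_one, smul_add, smul_smul]
  module

theorem vecMul_gaugedU (x β : ℂ) (i j : Fin 2) (ψ : Config N → ℂ) :
    ψ ᵥ* p.gaugedU (x + p.η / 2) β i j = exp (-x) •
      contr (fun b => p.gaugeG (-x) β b j) (tens ((p.gaugeG x β)⁻¹ i) ψ ᵥ* p.opU x) := by
  rw [gaugedU_apply]
  ext t
  simp only [vecMul, dotProduct, contr, tens, opU, flat, of_apply, Pi.smul_apply, smul_eq_mul,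
    Fintype.sum_prod_type, Fin.sum_univ_two, Matrix.smul_apply, Matrix.add_apply, Finset.mul_sum,
    ← Finset.sum_add_distrib]
  exact Finset.sum_congr rfl fun s _ => by ring

theorem gaugedU_mulVec (x β : ℂ) (i j : Fin 2) (φ : Config N → ℂ) :
    p.gaugedU (x + p.η / 2) β i j *ᵥ φ = exp (-x) •
      contr ((p.gaugeG x β)⁻¹ i) (p.opU x *ᵥ tens (fun b => p.gaugeG (-x) β b j) φ) := by
  rw [gaugedU_apply]
  ext t
  simp only [mulVec, dotProduct, contr, tens, opU, flat, of_apply, Pi.smul_apply, smul_eq_mul,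
    Fintype.sum_prod_type, Fin.sum_univ_two, Matrix.smul_apply, Matrix.add_apply, Finset.mul_sum,
    ← Finset.sum_add_distrib]
  exact Finset.sum_congr rfl fun s _ => by ring

theorem gaugeG_col_one (x β : ℂ) : (fun b => p.gaugeG x β b 1) = colVec (p.gaugeParam β) x := by
  ext b
  fin_cases b <;> simp [gaugeG, gaugeY, colVec, gaugeParam, ← exp_add]
  ring_nf

theorem gaugeG_col_zero (x β : ℂ) :
    (fun b => p.gaugeG x β b 0) = colVec (exp (-((p.α + β + 1) * p.η))) x := by
  ext b
  fin_cases b <;> simp [gaugeG, gaugeX, colVec, ← exp_add]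
  ring_nf

theorem gaugeG_eq (x β : ℂ) : p.gaugeG x β =
    !![exp (-x) * exp (-((p.α + β + 1) * p.η)), exp (-x) * p.gaugeParam β; 1, 1] := by
  ext i j
  have h0 := congrFun (p.gaugeG_col_zero x β) i
  have h1 := congrFun (p.gaugeG_col_one x β) i
  fin_cases i <;> fin_cases j <;> simpa [colVec] using by first | exact h0 | exact h1

theorem gaugeG_inv (x β : ℂ) : (p.gaugeG x β)⁻¹ =
    (exp (-x) * (exp (-((p.α + β + 1) * p.η)) - p.gaugeParam β))⁻¹ •
      !![1, -(exp (-x) * p.gaugeParam β); -1, exp (-x) * exp (-((p.α + β + 1) * p.η))] := by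
  rw [gaugeG_eq, Matrix.inv_def, adjugate_fin_two_of, det_fin_two_of, Ring.inverse_eq_inv']
  ring_nf

theorem gaugeParam_ne {β : ℂ} (hβ : sinh (β * p.η) ≠ 0) :
    exp (-((p.α + β + 1) * p.η)) - p.gaugeParam β ≠ 0 := by
  have h : exp (-((p.α + β + 1) * p.η)) - p.gaugeParam β =
      -2 * exp (-((p.α + 1) * p.η)) * sinh (β * p.η) := by
    rw [gaugeParam, show -((p.α + β + 1) * p.η) = -((p.α + 1) * p.η) + -(β * p.η) by ring,
      show -((p.α - β + 1) * p.η) = -((p.α + 1) * p.η) + β * p.η by ring, exp_add, exp_add, sinh]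
    ring
  rw [h]
  exact mul_ne_zero (mul_ne_zero (by norm_num) (exp_ne_zero _)) hβ

/-- Only the second column of the gauge matrix matters: the first row of its inverse is proportional
to the covector annihilating that column. The normalization cancels against the contraction with the
first column at -x. -/
theorem vecMul_opA {β x : ℂ} (hβ : sinh (β * p.η) ≠ 0) {ψ ψ' : Config N → ℂ}
    (h : RowMap p.opU (p.gaugeParam β) x ψ ψ') :
    ψ ᵥ* p.opA (x + p.η / 2) (β + 2) = exp x • ψ' := by
  have hne := p.gaugeParam_ne hβ
  have hrow : (p.gaugeG x β)⁻¹ 0 =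
      (exp (-x) * (exp (-((p.α + β + 1) * p.η)) - p.gaugeParam β))⁻¹ •
        rowVec (p.gaugeParam β) x := by
    rw [gaugeG_inv]
    ext b
    fin_cases b <;> simp [rowVec]
  unfold RowMap at h
  rw [opA, add_sub_cancel_right, vecMul_gaugedU, hrow, smul_tens, smul_vecMul, h, contr_smul,
    gaugeG_col_zero, contr_tens, smul_smul, smul_smul]
  congr 1
  generalize exp (-((p.α + β + 1) * p.η)) = r at hne ⊢
  simp only [rowVec, colVec, dotProduct, Fin.sum_univ_two, cons_val_zero, cons_val_one, neg_neg,
    exp_neg x]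
  field_simp
  ring

theorem opD_mulVec {β x : ℂ} (hβ : sinh (β * p.η) ≠ 0) {φ φ' : Config N → ℂ}
    (h : ColMap p.opU (p.gaugeParam β) x φ φ') :
    p.opD (x + p.η / 2) β *ᵥ φ = exp (-x) • φ' := by
  have hne := p.gaugeParam_ne hβ
  unfold ColMap at h
  rw [opD, gaugedU_mulVec, gaugeG_col_one, h, contr_tens, smul_smul, gaugeG_inv]
  congr 1
  simp only [colVec, dotProduct, Fin.sum_univ_two, cons_val_zero, cons_val_one, Matrix.smul_apply,
    of_apply, smul_eq_mul, exp_neg x]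
  field_simp
  ring

theorem gaugeParam_mul_exp (β : ℂ) (z : ℂ) :
    p.gaugeParam β * exp (z * p.η) = p.gaugeParam (β + z) := by
  rw [gaugeParam, gaugeParam, ← exp_add]
  ring_nf

/-- Each factor (-1, ·) of the reference covector is minus a gauge covector, whence the sign. -/
theorem leftRef_eq : ∀ {N : ℕ} (p : Params N) (β : ℂ),
    p.leftRef β = (-1 : ℂ) ^ N • p.leftState (p.gaugeParam β) 0
  | 0, p, β => by
    ext s
    simp [leftRef, leftState]
  | N + 1, p, β => by
    have ih := leftRef_eq p.init (β + 1)
    have hg : p.gaugeParam β * exp p.η = p.init.gaugeParam (β + 1) := by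
      have := p.gaugeParam_mul_exp β 1
      rw [one_mul] at this
      rw [this]
      rfl
    ext s
    rw [leftState, Pi.zero_apply, if_pos rfl, hg,
      show (Fin.init (0 : Config (N + 1)) : Config N) = 0 from rfl]
    have ih' := congrFun ih (Fin.init s)
    rw [Pi.smul_apply, smul_eq_mul] at ih'
    have hprod : p.leftRef β s = p.init.leftRef (β + 1) (Fin.init s) *
        ![-1, exp (-p.α * p.η + β * p.η - p.ξ (Fin.last N))] (s (Fin.last N)) := by
      simp only [leftRef, Fin.prod_univ_castSucc, init, Fin.init, Fin.val_castSucc, Fin.val_last]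
      push_cast
      congr 1
      · refine Finset.prod_congr rfl fun n _ => ?_
        ring_nf
      · ring_nf
    rw [hprod, ih']
    simp only [Pi.smul_apply, Function.comp_apply, lastEquiv, Equiv.coe_fn_mk, leftExt, tens,
      smul_eq_mul]
    generalize s (Fin.last N) = a
    have he : exp (-p.ξ (Fin.last N)) * p.init.gaugeParam (β + 1) =
        exp (-p.α * p.η + β * p.η - p.ξ (Fin.last N)) := by
      rw [gaugeParam, ← exp_add, init]
      ring_nf
    fin_cases a
    · simp [rowVec, pow_succ]
    · simp [rowVec, pow_succ, he]; ring

/-- The shift by 2 arises because stripping a site lowers β by one here, whereas for the left states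
it raises β by one. -/
theorem rightRef_eq : ∀ {N : ℕ} (p : Params N) (β : ℂ),
    p.rightRef (-β + 2) = p.rightState (p.gaugeParam β) 1
  | 0, p, β => by
    ext s
    simp [rightRef, rightState]
  | N + 1, p, β => by
    have ih := rightRef_eq p.init (β - 1)
    have hg : p.gaugeParam β * exp (-p.η) = p.init.gaugeParam (β - 1) := by
      have := p.gaugeParam_mul_exp β (-1)
      rw [neg_one_mul] at this
      rw [this]
      rfl
    ext s
    rw [rightState, Pi.one_apply, if_pos rfl, hg,
      show (Fin.init (1 : Config (N + 1)) : Config N) = 1 from rfl]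
    have ih' := congrFun ih (Fin.init s)
    have hprod : p.rightRef (-β + 2) s = p.init.rightRef (-(β - 1) + 2) (Fin.init s) *
        ![exp (-p.α * p.η - (-β + 2) * p.η - p.ξ (Fin.last N)), 1] (s (Fin.last N)) := by
      simp only [rightRef, Fin.prod_univ_castSucc, init, Fin.init, Fin.val_castSucc, Fin.val_last]
      push_cast
      congr 1
      · refine Finset.prod_congr rfl fun n _ => ?_
        ring_nf
      · ring_nf
    rw [hprod, ih']
    simp only [Function.comp_apply, lastEquiv, Equiv.coe_fn_mk, rightExt, tens]
    generalize s (Fin.last N) = a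
    have he : exp (-p.ξ (Fin.last N)) * p.init.gaugeParam (β - 1) =
        exp (-p.α * p.η - (-β + 2) * p.η - p.ξ (Fin.last N)) := by
      rw [gaugeParam, ← exp_add, init]
      ring_nf
    fin_cases a
    · simp [colVec, he, mul_comm]
    · simp [colVec]

theorem leftSOV_eq {β : ℂ} (hβ : sinh (β * p.η) ≠ 0) (h : Config N) :
    p.leftSOV β h = ((-1 : ℂ) ^ N * ∏ n, if h n = 0 then 1 else
      exp (-p.ξ n) * p.leftConst n / p.AMinus (p.η / 2 - p.ξ n)) •
        p.leftState (p.gaugeParam β) h := by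
  have key := vecMul_list_prod (p.leftState (p.gaugeParam β))
    (fun n => (1 / p.AMinus (p.η / 2 - p.ξ n)) • p.opA (p.η / 2 - p.ξ n) (β + 2))
    (fun n => exp (-p.ξ n) * p.leftConst n / p.AMinus (p.η / 2 - p.ξ n))
    (fun g n hn => by
      have := p.vecMul_opA hβ (p.rowMap_leftState (p.gaugeParam β) g n hn)
      rw [neg_add_eq_sub] at this
      rw [vecMul_smul, this, smul_smul, smul_smul]
      congr 1
      ring) h (List.finRange N) 0 (List.nodup_finRange N) (fun _ _ => rfl)
  rw [leftSOV, leftRef_eq, smul_vecMul, List.ofFn_eq_map, key, smul_smul, ← List.ofFn_eq_map,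
    List.prod_ofFn]
  simp

theorem rightSOV_eq {β : ℂ} (hβ : sinh (β * p.η) ≠ 0) (c : Fin N → ℂ) (h : Config N) :
    p.rightSOV c β h = (∏ n, if h n = 0 then
      exp (-p.ξ n) * p.rightConst n / (c n * p.AMinus (p.η / 2 - p.ξ n)) else 1) •
        p.rightState (p.gaugeParam β) h := by
  have key := list_prod_mulVec (p.rightState (p.gaugeParam β))
    (fun n => (1 / (c n * p.AMinus (p.η / 2 - p.ξ n))) • p.opD (p.ξ n + p.η / 2) β)
    (fun n => exp (-p.ξ n) * p.rightConst n / (c n * p.AMinus (p.η / 2 - p.ξ n)))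
    (fun g n hn => by
      have := p.opD_mulVec hβ (p.colMap_rightState (p.gaugeParam β) g n hn)
      rw [smul_mulVec, this, smul_smul, smul_smul]
      congr 1
      ring) h (List.finRange N) 1 (List.nodup_finRange N) (fun _ _ => rfl)
  rw [rightSOV, rightRef_eq, List.ofFn_eq_map, key, ← List.ofFn_eq_map, List.prod_ofFn]
  simp

end Params

theorem exp_eq_neg_one_iff {z : ℂ} :
    exp z = -1 ↔ ∃ n : ℤ, z = (Real.pi : ℂ) * I + n * (2 * Real.pi * I) := by
  rw [← exp_pi_mul_I, exp_eq_exp_iff_exists_int]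

theorem prod_prod_lt_comm {N : ℕ} (f : Fin N → Fin N → ℂ) :
    (∏ n, ∏ m, if n < m then f n m else 1) = ∏ n, ∏ m, if m < n then f m n else 1 :=
  Finset.prod_comm

theorem prod_Iio_eq {N : ℕ} (n : Fin N) (f : Fin N → ℂ) :
    ∏ m ∈ Finset.Iio n, f m = ∏ m, if m < n then f m else 1 := by
  rw [← Finset.prod_filter]
  congr 1
  ext m
  simp

theorem sum_smul_vecMulVec_eq_one {ι : Type*} [Fintype ι] [DecidableEq ι] {l r : ι → ι → ℂ}
    {d : ι → ℂ} (hd : ∀ i, d i ≠ 0) (h : ∀ i j, l i ⬝ᵥ r j = if i = j then d i else 0) :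
    (1 : Matrix ι ι ℂ) = ∑ i, (d i)⁻¹ • vecMulVec (r i) (l i) := by
  have hLR : (Matrix.of fun i s => (d i)⁻¹ * l i s) * (Matrix.of r)ᵀ = 1 := by
    ext i j
    have : ((Matrix.of fun i s => (d i)⁻¹ * l i s) * (Matrix.of r)ᵀ) i j =
        (d i)⁻¹ * (l i ⬝ᵥ r j) := by
      simp [mul_apply, dotProduct, Finset.mul_sum, mul_assoc]
    rw [this, h, one_apply]
    split_ifs
    · exact inv_mul_cancel₀ (hd i)
    · exact mul_zero _
  -- Biorthogonality is a one-sided inverse relation; for square matrices it is two-sided, and the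
  -- other side is the resolution of the identity.
  rw [mul_eq_one_comm] at hLR
  rw [← hLR]
  ext s t
  simp only [mul_apply, transpose_apply, of_apply, Matrix.sum_apply, Matrix.smul_apply,
    vecMulVec_apply, smul_eq_mul]
  exact Finset.sum_congr rfl fun i _ => by ring

/-! ### Closed form of the pairing and its dependence on the labels. -/

namespace Params

variable {N : ℕ}

/-- The spectral value at which the site `n` with label `a` enters the pairings. -/
noncomputable def specVal (p : Params N) (a : Fin 2) (n : Fin N) : ℂ :=
  if a = 0 then p.ξ n else -p.ξ n

/-- Site `n`, counted from 0, is reached after stripping N-1-n sites, each multiplying the gauge by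
e^{-η}. Its pseudo-eigenvalue sees K_- a further factor e^{(n+1)η} inside, which gives the exponent
2n+2-N. -/
theorem leftState_dotProduct_rightState : ∀ {N : ℕ} (p : Params N) (u : ℂ) (h k : Config N),
    p.leftState u h ⬝ᵥ p.rightState (u * exp (2 * p.η)) k = if h = k then
      ∏ n, (sinh (2 * p.specVal (h n) n) / sinh p.ζm *
        p.gaugedK (u * exp ((2 * (n : ℕ) + 2 - N) * p.η)) *
        ∏ m, if m < n then p.eigFactor (h m) m (p.specVal (h n) n) else 1) else 0
  | 0, p, u, h, k => by
    rw [if_pos (Subsingleton.elim h k)]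
    simp [dotProduct, leftState, rightState]
  | N + 1, p, u, h, k => by
    have ih := leftState_dotProduct_rightState p.init (u * exp (-p.η)) (Fin.init h) (Fin.init k)
    rw [leftState_dotProduct_rightState_succ]
    have hiff : h = k ↔ h (Fin.last N) = k (Fin.last N) ∧ (Fin.init h : Config N) = Fin.init k := by
      refine ⟨fun e => by simp [e], fun ⟨e1, e2⟩ => funext fun n => ?_⟩
      exact Fin.lastCases e1 (fun n => congrFun e2 n) n
    by_cases hl : h (Fin.last N) = k (Fin.last N)
    · rw [if_pos hl]
      change _ * (_ ⬝ᵥ p.init.rightState (u * exp (-p.η) * exp (2 * p.init.η)) _) = _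
      rw [ih]
      by_cases hi : (Fin.init h : Config N) = Fin.init k
      · rw [if_pos hi, if_pos (hiff.2 ⟨hl, hi⟩), Fin.prod_univ_castSucc, mul_comm]
        congr 1
        · refine Finset.prod_congr rfl fun n _ => ?_
          rw [Fin.prod_univ_castSucc, if_neg (Fin.castSucc_lt_last n).not_gt, mul_one]
          have : u * exp (-p.η) * exp ((2 * (n : ℕ) + 2 - N) * p.η) =
              u * exp ((2 * ((n.castSucc : Fin (N + 1)) : ℕ) + 2 - ((N + 1 : ℕ) : ℂ)) * p.η) := by
            rw [mul_assoc, ← exp_add, Fin.val_castSucc]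
            push_cast
            ring_nf
          rw [← this]
          simp only [Fin.castSucc_lt_castSucc_iff]
          rfl
        · rw [Fin.prod_univ_castSucc, if_neg (lt_irrefl _), mul_one]
          simp only [Fin.castSucc_lt_last, if_true]
          have : u * exp p.η * exp (N * p.η) =
              u * exp ((2 * ((Fin.last N : Fin (N + 1)) : ℕ) + 2 - ((N + 1 : ℕ) : ℂ)) * p.η) := by
            rw [mul_assoc, ← exp_add, Fin.val_last]
            push_cast
            ring_nf
          rw [← this]
          rfl
      · rw [if_neg hi, if_neg fun e => hi (hiff.1 e).2, mul_zero]
    · rw [if_neg hl, if_neg fun e => hl (hiff.1 e).1]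

variable (p : Params N)

/-- The part of the pairing that depends on the labels `a`, `b` of the sites `m < n`. -/
noncomputable def pairFactor (m n : Fin N) (a b : Fin 2) : ℂ :=
  (if a = 0 then sinh (p.ξ m - p.ξ n + p.η) * sinh (p.ξ m + p.ξ n + p.η)
    else sinh (-p.ξ m - p.ξ n + p.η) * sinh (-p.ξ m + p.ξ n + p.η)) *
  p.eigFactor a m (p.specVal b n)

/-- The part of the pairing that does not depend on the labels. -/
noncomputable def pairConst (β : ℂ) : ℂ :=
  (-1) ^ N * ∏ n, (exp (-p.ξ n) / p.AMinus (p.η / 2 - p.ξ n) *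
    (p.gaugedK (p.gaugeParam (β - 2) * exp ((2 * (n : ℕ) + 2 - N) * p.η)) / sinh p.ζm) *
    (sinh p.η * sinh (p.η - 2 * p.ξ n) * sinh (-(2 * p.ξ n))))

theorem leftSOV_dotProduct_rightSOV {β : ℂ} (hβ : sinh (β * p.η) ≠ 0)
    (hβ2 : sinh ((β - 2) * p.η) ≠ 0) (h2 : ∀ n, sinh (2 * p.ξ n + p.η) ≠ 0)
    (h2' : ∀ n, sinh (2 * p.ξ n - p.η) ≠ 0) (h k : Config N) :
    p.leftSOV (β - 2) h ⬝ᵥ p.rightSOV p.kNorm β k = if h = k then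
      p.pairConst β * ∏ n, ∏ m, if m < n then p.pairFactor m n (h m) (h n) else 1 else 0 := by
  have hg : p.gaugeParam β = p.gaugeParam (β - 2) * exp (2 * p.η) := by
    rw [gaugeParam_mul_exp, sub_add_cancel]
  rw [leftSOV_eq p hβ2, rightSOV_eq p hβ, smul_dotProduct, dotProduct_smul, hg,
    leftState_dotProduct_rightState]
  by_cases hk : h = k
  swap
  · simp [hk]
  subst hk
  simp only [if_true, smul_eq_mul]
  -- The raising and lowering constants of a site run over later sites, the pseudo-eigenvalues over
  -- earlier ones; both are collected by pairs m < n.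
  have hsplit : (∏ n, ∏ m, if m < n then p.pairFactor m n (h m) (h n) else 1) =
      ∏ n, ((∏ m, if n < m then
        (if h n = 0 then sinh (p.ξ n - p.ξ m + p.η) * sinh (p.ξ n + p.ξ m + p.η)
          else sinh (-p.ξ n - p.ξ m + p.η) * sinh (-p.ξ n + p.ξ m + p.η)) else 1) *
        ∏ m, if m < n then p.eigFactor (h m) m (p.specVal (h n) n) else 1) := by
    rw [Finset.prod_mul_distrib, prod_prod_lt_comm, ← Finset.prod_mul_distrib]
    refine Finset.prod_congr rfl fun n _ => ?_
    rw [← Finset.prod_mul_distrib]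
    refine Finset.prod_congr rfl fun m _ => ?_
    split_ifs <;> simp_all [pairFactor]
  rw [hsplit, pairConst, mul_assoc, mul_assoc, ← Finset.prod_mul_distrib,
    ← Finset.prod_mul_distrib, ← Finset.prod_mul_distrib]
  congr 1
  refine Finset.prod_congr rfl fun n _ => ?_
  -- The normalization k_n replaces sinh(2ξ_n+η) by sinh(2ξ_n-η), which makes the one-site factor
  -- equal for both labels.
  by_cases hn : h n = 0
  · simp only [hn, if_true, specVal, rightConst, kNorm]
    have e1 : sinh (p.η - 2 * p.ξ n) = -sinh (2 * p.ξ n - p.η) := by rw [← sinh_neg]; ring_nf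
    rw [e1, sinh_neg]
    have := h2 n
    have := h2' n
    generalize sinh (2 * p.ξ n + p.η) = x at *
    generalize sinh (2 * p.ξ n - p.η) = y at *
    rw [mul_comm (x / y), ← div_div, div_div_eq_mul_div]
    field_simp
  · simp only [hn, if_false, specVal, leftConst]
    rw [mul_neg]
    ring

theorem etaVal_sub_etaVal (m n : Fin N) (a b : Fin 2) :
    p.etaVal n b - p.etaVal m a =
      2 * sinh (p.ξ n + p.ξ m + ((a : ℕ) + (b : ℕ) - 1) * p.η) *
        sinh (p.ξ n - p.ξ m + ((b : ℕ) - (a : ℕ)) * p.η) := by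
  have key : ∀ x y : ℂ, cosh (x + y) - cosh (x - y) = 2 * sinh x * sinh y := fun x y => by
    rw [cosh_add, cosh_sub]
    ring
  rw [← key, etaVal, etaVal]
  ring_nf

/-- For all labels the product is, with one common sign, twice the product over r = -1, 0, 1 of
sinh(ξ_n+ξ_m+rη) sinh(ξ_n-ξ_m+rη). The pair factor contains four of these six terms and the
difference of the η's supplies the other two. -/
theorem pairFactor_mul (m n : Fin N) (a b : Fin 2) :
    p.pairFactor m n a b * (p.etaVal n b - p.etaVal m a) =
      p.pairFactor m n 1 1 * (p.etaVal n 1 - p.etaVal m 1) := by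
  have o1 : sinh (-p.ξ m - p.ξ n + p.η) = -sinh (p.ξ n + p.ξ m - p.η) := by
    rw [← sinh_neg]; ring_nf
  have o2 : sinh (-p.ξ m + p.ξ n + p.η) = sinh (p.ξ n - p.ξ m + p.η) := by ring_nf
  have o3 : sinh (p.ξ m - p.ξ n + p.η) = -sinh (p.ξ n - p.ξ m - p.η) := by
    rw [← sinh_neg]; ring_nf
  have o4 : sinh (p.ξ m + p.ξ n + p.η) = sinh (p.ξ n + p.ξ m + p.η) := by ring_nf
  have o5 : sinh (-p.ξ n - p.ξ m + p.η) = -sinh (p.ξ n + p.ξ m - p.η) := by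
    rw [← sinh_neg]; ring_nf
  have o6 : sinh (-p.ξ n + p.ξ m) = -sinh (p.ξ n - p.ξ m) := by
    rw [← sinh_neg]; ring_nf
  have o7 : sinh (-p.ξ n + p.ξ m + p.η) = -sinh (p.ξ n - p.ξ m - p.η) := by
    rw [← sinh_neg]; ring_nf
  have o8 : sinh (-p.ξ n - p.ξ m) = -sinh (p.ξ n + p.ξ m) := by
    rw [← sinh_neg]; ring_nf
  rw [etaVal_sub_etaVal, etaVal_sub_etaVal]
  fin_cases a <;> fin_cases b <;>
    simp [pairFactor, eigFactor, specVal, o1, o2, o3, o4, o5, o6, o7, o8, ← sub_eq_add_neg] <;> ring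

theorem normZ_eq {β : ℂ} (hβ : sinh (β * p.η) ≠ 0)
    (hβ2 : sinh ((β - 2) * p.η) ≠ 0) (h2 : ∀ n, sinh (2 * p.ξ n + p.η) ≠ 0)
    (h2' : ∀ n, sinh (2 * p.ξ n - p.η) ≠ 0) :
    p.normZ (β - 2) = p.pairConst β * ∏ n, ∏ m, if m < n then
      p.pairFactor m n 1 1 * (p.etaVal n 1 - p.etaVal m 1) else 1 := by
  have key := p.leftSOV_dotProduct_rightSOV hβ hβ2 h2 h2' 1 1
  -- With all labels 1 no D acts, so this pairing is precisely the matrix element in Z(β-2).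
  have hr : p.rightSOV p.kNorm β 1 = p.rightRef (-(β - 2)) := by
    simp [rightSOV, neg_add_eq_sub]
  rw [hr, if_pos rfl, leftSOV, ← dotProduct_mulVec] at key
  simp only [Pi.one_apply, Fin.val_one, pow_one] at key
  rw [normZ, key, mul_left_comm]
  simp only [prod_Iio_eq, ← Finset.prod_mul_distrib]
  congr 1
  refine Finset.prod_congr rfl fun n _ => Finset.prod_congr rfl fun m _ => ?_
  split_ifs
  · ring
  · ring

theorem leftSOV_dotProduct_rightSOV_kNorm {β : ℂ} (hβ : sinh (β * p.η) ≠ 0)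
    (hβ2 : sinh ((β - 2) * p.η) ≠ 0) (h2 : ∀ n, sinh (2 * p.ξ n + p.η) ≠ 0)
    (h2' : ∀ n, sinh (2 * p.ξ n - p.η) ≠ 0)
    (hD : ∀ m n, m < n → ∀ a b, p.etaVal n b - p.etaVal m a ≠ 0) (h k : Config N) :
    p.leftSOV (β - 2) h ⬝ᵥ p.rightSOV p.kNorm β k = if h = k then
      p.normZ (β - 2) * ∏ a : Fin N, ∏ b ∈ Finset.Iio a, 1 / (p.etaVal a (h a) - p.etaVal b (h b))
      else 0 := by
  rw [leftSOV_dotProduct_rightSOV p hβ hβ2 h2 h2', normZ_eq p hβ hβ2 h2 h2', mul_assoc]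
  simp only [prod_Iio_eq, ← Finset.prod_mul_distrib]
  congr 2
  refine Finset.prod_congr rfl fun n _ => Finset.prod_congr rfl fun m _ => ?_
  split_ifs with hmn
  · rw [← pairFactor_mul p m n (h m) (h n), mul_assoc, mul_one_div_cancel (hD m n hmn _ _), mul_one]
  · rw [mul_one]

/-! ### Non-vanishing of the pairings. -/

theorem exp_ζm (hκ : p.κm ≠ 0) (hαβ : p.BoundaryRelation) :
    exp p.ζm = 2 * p.κm * sinh (p.αm + p.βm) := by
  rw [sinh_add, hαβ.1, hαβ.2, ← cosh_add_sinh]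
  field_simp
  ring

/-- The gauged boundary entry is a quadratic polynomial in v; eliminating ζ_- in favour of α_- + β_-
exhibits its two roots. -/
theorem gaugedK_exp (hκ : p.κm ≠ 0) (hαβ : p.BoundaryRelation) (X : ℂ) :
    p.gaugedK (exp (p.τm - X)) =
      p.κm * exp p.τm * ((1 - exp (-X - (p.αm + p.βm))) * (1 + exp (-X + (p.αm + p.βm)))) := by
  rw [gaugedK, exp_ζm p hκ hαβ, sinh, exp_sub, exp_neg p.τm, exp_sub, exp_add (-X), exp_neg X,
    exp_neg (p.αm + p.βm)]
  field_simp
  ring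

theorem gaugedK_ne_zero (hκ : p.κm ≠ 0) (hαβ : p.BoundaryRelation) {X : ℂ}
    (hX : ∀ k : ℤ, X ≠ -(-1 : ℂ) ^ k * (p.αm + p.βm) + I * Real.pi * k) :
    p.gaugedK (exp (p.τm - X)) ≠ 0 := by
  rw [gaugedK_exp p hκ hαβ]
  refine mul_ne_zero (mul_ne_zero hκ (exp_ne_zero _)) (mul_ne_zero (fun h0 => ?_) fun h0 => ?_)
  · obtain ⟨n, hn⟩ := exp_eq_one_iff.1 (sub_eq_zero.1 h0).symm
    -- Zeros of the first factor are the excluded values with even k; those of the second have odd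
    -- k.
    refine hX (2 * -n) ?_
    rw [_root_.zpow_mul, show (-1 : ℂ) ^ (2 : ℤ) = 1 by norm_num, _root_.one_zpow]
    push_cast
    linear_combination -hn
  · obtain ⟨n, hn⟩ := exp_eq_neg_one_iff.1 (eq_neg_of_add_eq_zero_right h0)
    refine hX (2 * (-n) - 1) ?_
    rw [zpow_sub_one₀ (by norm_num), _root_.zpow_mul, show (-1 : ℂ) ^ (2 : ℤ) = 1 by norm_num, _root_.one_zpow]
    push_cast
    rw [show ((-1 : ℂ))⁻¹ = -1 by norm_num]
    linear_combination -hn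

theorem gaugeParam_mul_exp_eq (β : ℂ) (n : ℂ) :
    p.gaugeParam (β - 2) * exp ((2 * n + 2 - N) * p.η) =
      exp (p.τm - ((p.α - (β - 2 * (N - n))) * p.η - (N - 1) * p.η + p.τm)) := by
  rw [gaugeParam, ← exp_add]
  ring_nf

theorem AMinus_ne_zero (hη : sinh p.η ≠ 0) (hζ : sinh p.ζm ≠ 0) (hκ : p.κm ≠ 0)
    (hαβ : p.BoundaryRelation)
    (hdiff : ∀ a b, a ≠ b → ∀ r : ℤ, |r| ≤ 1 → sinh (p.ξ a - p.ξ b + (r : ℂ) * p.η) ≠ 0)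
    (hsum : ∀ a b, ∀ r : ℤ, |r| ≤ 1 → sinh (p.ξ a + p.ξ b + (r : ℂ) * p.η) ≠ 0)
    (hbdry : ∀ a, sinh (p.αm - p.ξ a) ≠ 0 ∧ cosh (p.βm - p.ξ a) ≠ 0) (n : Fin N) :
    p.AMinus (p.η / 2 - p.ξ n) ≠ 0 := by
  rw [AMinus, gMinus, aFun, dFun, aFun]
  refine mul_ne_zero (mul_ne_zero (div_ne_zero (mul_ne_zero ?_ ?_) ?_) ?_) ?_
  · rw [show p.η / 2 - p.ξ n + p.αm - p.η / 2 = p.αm - p.ξ n by ring]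
    exact (hbdry n).1
  · rw [show p.η / 2 - p.ξ n + p.βm - p.η / 2 = p.βm - p.ξ n by ring]
    exact (hbdry n).2
  · rw [hαβ.1]
    exact div_ne_zero hζ (mul_ne_zero two_ne_zero hκ)
  · refine Finset.prod_ne_zero_iff.2 fun m _ => ?_
    rw [show p.η / 2 - p.ξ n - p.ξ m + p.η / 2 = -(p.ξ n + p.ξ m + ((-1 : ℤ) : ℂ) * p.η) by
      push_cast; ring, sinh_neg]
    exact neg_ne_zero.2 (hsum n m (-1) (by norm_num))
  · refine Finset.prod_ne_zero_iff.2 fun m _ => ?_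
    rw [show -(p.η / 2 - p.ξ n) - p.η - p.ξ m + p.η / 2 = p.ξ n - p.ξ m + ((-1 : ℤ) : ℂ) * p.η by
      push_cast; ring]
    -- The diagonal term is sinh(-η), which is covered by the assumption on η and not by the one on
    -- differences.
    by_cases hnm : n = m
    · subst hnm
      rw [sub_self, zero_add, Int.cast_neg, Int.cast_one, neg_one_mul, sinh_neg]
      exact neg_ne_zero.2 hη
    · exact hdiff n m hnm (-1) (by norm_num)

theorem etaVal_sub_etaVal_ne_zero
    (hdiff : ∀ a b, a ≠ b → ∀ r : ℤ, |r| ≤ 1 → sinh (p.ξ a - p.ξ b + (r : ℂ) * p.η) ≠ 0)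
    (hsum : ∀ a b, ∀ r : ℤ, |r| ≤ 1 → sinh (p.ξ a + p.ξ b + (r : ℂ) * p.η) ≠ 0)
    {m n : Fin N} (hmn : n ≠ m) (a b : Fin 2) : p.etaVal n b - p.etaVal m a ≠ 0 := by
  have hs := hsum n m ((a : ℕ) + (b : ℕ) - 1) (by fin_cases a <;> fin_cases b <;> norm_num)
  have hd := hdiff n m hmn ((b : ℕ) - (a : ℕ)) (by fin_cases a <;> fin_cases b <;> norm_num)
  push_cast at hs hd
  rw [etaVal_sub_etaVal]
  exact mul_ne_zero (mul_ne_zero two_ne_zero hs) hd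

theorem pairFactor_ne_zero
    (hdiff : ∀ a b, a ≠ b → ∀ r : ℤ, |r| ≤ 1 → sinh (p.ξ a - p.ξ b + (r : ℂ) * p.η) ≠ 0)
    (hsum : ∀ a b, ∀ r : ℤ, |r| ≤ 1 → sinh (p.ξ a + p.ξ b + (r : ℂ) * p.η) ≠ 0)
    {m n : Fin N} (hmn : n ≠ m) : p.pairFactor m n 1 1 ≠ 0 := by
  have hs := hsum n m (-1) (by norm_num)
  have hs0 := hsum n m 0 (by norm_num)
  have hd := hdiff n m hmn 1 (by norm_num)
  have hd' := hdiff m n hmn.symm 1 (by norm_num)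
  have o1 : sinh (-p.ξ m - p.ξ n + p.η) = -sinh (p.ξ n + p.ξ m + ((-1 : ℤ) : ℂ) * p.η) := by
    rw [← sinh_neg]; push_cast; ring_nf
  have o2 : sinh (-p.ξ m + p.ξ n + p.η) = sinh (p.ξ n - p.ξ m + ((1 : ℤ) : ℂ) * p.η) := by
    push_cast; ring_nf
  have o3 : sinh (-p.ξ n + p.ξ m + p.η) = sinh (p.ξ m - p.ξ n + ((1 : ℤ) : ℂ) * p.η) := by
    push_cast; ring_nf
  have o4 : sinh (-p.ξ n - p.ξ m) = -sinh (p.ξ n + p.ξ m + ((0 : ℤ) : ℂ) * p.η) := by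
    rw [← sinh_neg]; push_cast; ring_nf
  simp only [pairFactor, eigFactor, specVal, if_neg one_ne_zero, o1, o2, o3, o4]
  exact mul_ne_zero (mul_ne_zero (neg_ne_zero.2 hs) hd) (mul_ne_zero hd' (neg_ne_zero.2 hs0))

theorem pairConst_ne_zero (hη : sinh p.η ≠ 0) (hζ : sinh p.ζm ≠ 0)
    (hsum : ∀ a b, ∀ r : ℤ, |r| ≤ 1 → sinh (p.ξ a + p.ξ b + (r : ℂ) * p.η) ≠ 0)
    (hA : ∀ n, p.AMinus (p.η / 2 - p.ξ n) ≠ 0) {β : ℂ}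
    (hK : ∀ n : Fin N, p.gaugedK (p.gaugeParam (β - 2) * exp ((2 * (n : ℕ) + 2 - N) * p.η)) ≠ 0) :
    p.pairConst β ≠ 0 := by
  refine mul_ne_zero (pow_ne_zero _ (by norm_num)) (Finset.prod_ne_zero_iff.2 fun n _ => ?_)
  refine mul_ne_zero (mul_ne_zero (div_ne_zero (exp_ne_zero _) (hA n)) (div_ne_zero (hK n) hζ))
    (mul_ne_zero (mul_ne_zero hη ?_) ?_)
  · rw [show p.η - 2 * p.ξ n = -(p.ξ n + p.ξ n + ((-1 : ℤ) : ℂ) * p.η) by push_cast; ring,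
      sinh_neg]
    exact neg_ne_zero.2 (hsum n n (-1) (by norm_num))
  · rw [show 2 * p.ξ n = p.ξ n + p.ξ n + ((0 : ℤ) : ℂ) * p.η by push_cast; ring, sinh_neg]
    exact neg_ne_zero.2 (hsum n n 0 (by norm_num))

/-! ### Change of normalization and passage to matrices. -/

theorem rightSOV_renormalize {β : ℂ} (hβ : sinh (β * p.η) ≠ 0) (f : Fin N → ℂ) {c c' : Fin N → ℂ}
    (hc : ∀ n, 1 / c' n = f n * (1 / c n)) (h : Config N) :
    p.rightSOV c' β h = (∏ n, f n ^ (1 - (h n : ℕ))) • p.rightSOV c β h := by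
  rw [rightSOV_eq p hβ, rightSOV_eq p hβ, smul_smul, ← Finset.prod_mul_distrib]
  congr 1
  refine Finset.prod_congr rfl fun n _ => ?_
  by_cases hn : h n = 0
  · rw [hn, if_pos rfl, if_pos rfl, Fin.val_zero, Nat.sub_zero, pow_one,
      mul_comm (c' n), mul_comm (c n), ← div_div, ← div_div, div_eq_mul_one_div _ (c' n), hc]
    ring
  · have h1 : h n = 1 := Fin.eq_one_of_ne_zero _ hn
    simp [h1]

theorem one_div_fNorm (β : ℂ) (n : Fin N) :
    1 / p.fNorm β n = sinh (2 * p.ξ n + β * p.η) / sinh (β * p.η) * (1 / p.kNorm n) := by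
  rw [fNorm, kNorm, one_div_div, one_div_div, mul_comm (sinh (2 * p.ξ n - p.η)), mul_div_mul_comm]
  ring

theorem matUL_mul_matUR_apply (c : Fin N → ℂ) (β β' : ℂ) (h k : Config N) :
    (p.matUL β' * p.matUR c β) (kappa N h) (kappa N k) =
      p.leftSOV β' h ⬝ᵥ p.rightSOV c β k := by
  -- The spin basis and the tensor basis differ by a permutation, which does not affect a sum over a
  -- complete basis.
  have hbij : Function.Bijective (spinPos : Config N → Config N) :=
    Function.Involutive.bijective fun k => funext fun n => Fin.rev_rev _
  rw [mul_apply, dotProduct]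
  simp only [matUL, matUR, of_apply, Equiv.symm_apply_apply]
  exact Fintype.sum_bijective (fun i => spinPos ((kappa N).symm i))
    (hbij.comp (kappa N).symm.bijective) _ _ fun _ => rfl

end Params

end OpenXXZ

/-! ### Assembly of the proposition. -/

theorem mainTheorem7 (N : ℕ) (p : OpenXXZ.Params N) (β : ℂ)
    (hη : Complex.sinh p.η ≠ 0) (hζ : Complex.sinh p.ζm ≠ 0) (hκ : p.κm ≠ 0)
    (hαβ : p.BoundaryRelation)
    -- genericity of the inhomogeneities
    (hdiff : ∀ a b, a ≠ b → ∀ r : ℤ, |r| ≤ 1 →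
      Complex.sinh (p.ξ a - p.ξ b + (r : ℂ) * p.η) ≠ 0)
    (hsum : ∀ a b, ∀ r : ℤ, |r| ≤ 1 → Complex.sinh (p.ξ a + p.ξ b + (r : ℂ) * p.η) ≠ 0)
    (hbdry : ∀ a, Complex.sinh (p.αm - p.ξ a) ≠ 0 ∧ Complex.cosh (p.βm - p.ξ a) ≠ 0)
    -- the gauge matrices are invertible
    (hβ : Complex.sinh (β * p.η) ≠ 0) (hβ2 : Complex.sinh ((β - 2) * p.η) ≠ 0) :
    -- `M = U^{(L,β-2)} U^{(R,β)}` is diagonal, with explicit entries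
    (p.matUL (β - 2) * p.matUR p.kNorm β).IsDiag ∧
    (∀ h k : OpenXXZ.Config N,
      (p.matUL (β - 2) * p.matUR p.kNorm β) (OpenXXZ.kappa N h) (OpenXXZ.kappa N k)
          = p.leftSOV (β - 2) h ⬝ᵥ p.rightSOV p.kNorm β k ∧
      p.leftSOV (β - 2) h ⬝ᵥ p.rightSOV p.kNorm β k =
        if h = k then
          p.normZ (β - 2) *
            ∏ a : Fin N, ∏ b ∈ Finset.Iio a, 1 / (p.etaVal a (h a) - p.etaVal b (h b))
        else 0) ∧
    -- the decomposition of the identity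
    ((∀ j : ℕ, 1 ≤ j → j ≤ N → ∀ k : ℤ,
        (p.α - (β - 2 * (j : ℂ))) * p.η ≠
          ((N : ℂ) - 1) * p.η - p.τm - (-1 : ℂ) ^ k * (p.αm + p.βm) + Complex.I * Real.pi * k) →
      p.normZ (β - 2) ≠ 0 ∧
      (∀ h : OpenXXZ.Config N, p.leftSOV (β - 2) h ⬝ᵥ p.rightSOV p.kNorm β h ≠ 0) ∧
      (1 : OpenXXZ.Op N) = ∑ h : OpenXXZ.Config N,
        (p.leftSOV (β - 2) h ⬝ᵥ p.rightSOV p.kNorm β h)⁻¹ •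
          Matrix.vecMulVec (p.rightSOV p.kNorm β h) (p.leftSOV (β - 2) h) ∧
      (1 : OpenXXZ.Op N) = (1 / p.normZ (β - 2)) • ∑ h : OpenXXZ.Config N,
        (∏ a : Fin N, ∏ b ∈ Finset.Iio a, (p.etaVal a (h a) - p.etaVal b (h b))) •
          Matrix.vecMulVec (p.rightSOV p.kNorm β h) (p.leftSOV (β - 2) h)) ∧
    -- the same entries for the right states normalized by `f_n(β)` instead of `k_n`
    ((∀ n, Complex.sinh (2 * p.ξ n + β * p.η) ≠ 0) →
      ∀ h k : OpenXXZ.Config N,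
        p.leftSOV (β - 2) h ⬝ᵥ p.rightSOV (p.fNorm β) β k =
          if h = k then
            p.normZ (β - 2) *
              (∏ n : Fin N, (Complex.sinh (2 * p.ξ n + β * p.η) / Complex.sinh (β * p.η)) ^
                (1 - (h n : ℕ))) *
              ∏ a : Fin N, ∏ b ∈ Finset.Iio a, 1 / (p.etaVal a (h a) - p.etaVal b (h b))
          else 0) := by
  have h2 : ∀ n, sinh (2 * p.ξ n + p.η) ≠ 0 := fun n => by
    have := hsum n n 1 (by norm_num)
    rwa [Int.cast_one, one_mul, ← two_mul] at this
  have h2' : ∀ n, sinh (2 * p.ξ n - p.η) ≠ 0 := fun n => by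
    have := hsum n n (-1) (by norm_num)
    rwa [Int.cast_neg, Int.cast_one, neg_one_mul, ← two_mul, ← sub_eq_add_neg] at this
  have hD : ∀ m n, m ≠ n → ∀ a b, p.etaVal n b - p.etaVal m a ≠ 0 := fun m n hmn =>
    p.etaVal_sub_etaVal_ne_zero hdiff hsum hmn.symm
  have key := p.leftSOV_dotProduct_rightSOV_kNorm hβ hβ2 h2 h2' fun m n hmn => hD m n hmn.ne
  have hA := p.AMinus_ne_zero hη hζ hκ hαβ hdiff hsum hbdry
  refine ⟨fun i j hij => ?_, fun h k => ⟨p.matUL_mul_matUR_apply _ _ _ h k, key h k⟩,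
    fun hgen => ?_, fun _ h k => ?_⟩
  · obtain ⟨h, rfl⟩ := (OpenXXZ.kappa N).surjective i
    obtain ⟨k, rfl⟩ := (OpenXXZ.kappa N).surjective j
    rw [p.matUL_mul_matUR_apply, key, if_neg fun e => hij (congrArg _ e)]
  · have hK : ∀ n : Fin N,
        p.gaugedK (p.gaugeParam (β - 2) * exp ((2 * (n : ℕ) + 2 - N) * p.η)) ≠ 0 := fun n => by
      rw [p.gaugeParam_mul_exp_eq]
      refine p.gaugedK_ne_zero hκ hαβ fun k hk => ?_
      -- Sites are counted from 0, so j = N - n runs through 1, …, N.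
      refine hgen (N - n) (by omega) (by omega) k ?_
      rw [Nat.cast_sub n.isLt.le]
      linear_combination hk
    have hZ : p.normZ (β - 2) ≠ 0 := by
      rw [p.normZ_eq hβ hβ2 h2 h2']
      refine mul_ne_zero (p.pairConst_ne_zero hη hζ hsum hA hK)
        (Finset.prod_ne_zero_iff.2 fun n _ => Finset.prod_ne_zero_iff.2 fun m _ => ?_)
      split_ifs with hmn
      · exact mul_ne_zero (p.pairFactor_ne_zero hdiff hsum hmn.ne') (hD m n hmn.ne 1 1)
      · exact one_ne_zero
    have hV : ∀ h : OpenXXZ.Config N,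
        (∏ a : Fin N, ∏ b ∈ Finset.Iio a, 1 / (p.etaVal a (h a) - p.etaVal b (h b))) ≠ 0 :=
      fun h => Finset.prod_ne_zero_iff.2 fun a _ => Finset.prod_ne_zero_iff.2 fun b hb =>
        one_div_ne_zero (hD b a (Finset.mem_Iio.1 hb).ne _ _)
    have hW : ∀ h : OpenXXZ.Config N, p.leftSOV (β - 2) h ⬝ᵥ p.rightSOV p.kNorm β h ≠ 0 :=
      fun h => by
        rw [key, if_pos rfl]
        exact mul_ne_zero hZ (hV h)
    have hone := OpenXXZ.sum_smul_vecMulVec_eq_one (l := fun h => p.leftSOV (β - 2) h)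
      (r := fun h => p.rightSOV p.kNorm β h) hW fun h k => by rw [key, key, if_pos rfl]
    refine ⟨hZ, hW, hone, hone.trans ?_⟩
    rw [Finset.smul_sum]
    refine Finset.sum_congr rfl fun h _ => ?_
    rw [smul_smul, key, if_pos rfl, mul_inv, one_div]
    simp only [← Finset.prod_inv_distrib, one_div, inv_inv]
  · rw [p.rightSOV_renormalize hβ _ (p.one_div_fNorm β), dotProduct_smul, key, smul_eq_mul]
    split_ifs with e
    · subst e
      rw [← mul_assoc, mul_comm (Finset.prod _ _)]
    · rw [mul_zero]
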